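/- Let $t=(t_1,t_2,t_3)$ be three distinct points of $\mathbb{P}^1=\mathbb{P}^1_{\mathbb{C}}$, $D=t_1+t_2+t_3$, and let $\nu=(\nu_{i,j})_{1\le i\le 3,\,0\le j\le 2}$ be complex numbers with $\sum_{i,j}\nu_{i,j}=2$. A $\nu$-parabolic $\phi$-connection of rank $3$ and degree $-2$ over $(\mathbb{P}^1,t)$ is a collection $(E_1,E_2,\phi,\nabla,l^{(1)}_*,l^{(2)}_*)$ where $E_1,E_2$ are vector bundles on $\mathbb{P}^1$ of rank $3$ and degree $-2$; for $k=1,2$ and $i=1,2,3$, $E_k|_{t_i}=l^{(k)}_{i,0}\supsetneq l^{(k)}_{i,1}\supsetneq l^{(k)}_{i,2}\supsetneq l^{(k)}_{i,3}=0$ is a flag; $\phi\colon E_1\to E_2$ is a homomorphism with $\phi_{t_i}(l^{(1)}_{i,j})\subset l^{(2)}_{i,j}$ for all $i,j$; and $\nabla\colon E_1\to E_2\otimes\Omega^1_{\mathbb{P}^1}(D)$ is additive with $\nabla(fs)=\phi(s)\otimes df+f\nabla(s)$ and $(\mathrm{res}_{t_i}\nabla-\nu_{i,j}\phi_{t_i})(l^{(1)}_{i,j})\subset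 l^{(2)}_{i,j+1}$ for $0\le j\le 2$. Let $\alpha=(\alpha_{i,j})_{1\le i,j\le 3}$ be pairwise distinct rational numbers with $0<\alpha_{i,1}<\alpha_{i,2}<\alpha_{i,3}<1$ for each $i$, and let $\gamma$ be a positive integer. For subbundles $F_k\subseteq E_k$ (i.e. with locally free quotient) with $(F_1,F_2)\ne(0,0)$ put $$\mu_\alpha(F_1,F_2)=\frac{\deg F_1+\deg F_2-\gamma\,\mathrm{rank}\,F_2+\sum_{i,j=1}^{3}\alpha_{i,j}\bigl(d^{(1)}_{i,j}(F_1)+d^{(2)}_{i,j}(F_2)\bigr)}{\mathrm{rank}\,F_1+\mathrm{rank}\,F_2},$$ where $d^{(k)}_{i,j}(F)=\dim\,(F|_{t_i}\cap l^{(k)}_{i,j-1})/(F|_{t_i}\cap l^{(k)}_{i,j})$. The parabolic $\phi$-connection is called $\alpha$-stable if $\mu_\alpha(F_1,F_2)<\mu_\alpha(E_1,E_2)$ for all pairs of subbundles $(F_1,F_2)\ne(0,0),(E_1,E_2)$ with $\phi(F_1)\subset F_2$ and $\nabla(F_1)\subset F_2\otimes\Omega^1_{\mathbb{P}^1}(D)$.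 There are $\varepsilon>0$ and $\gamma_0$ such that for all such $\alpha$ with $\alpha_{i,j}<\varepsilon$ for all $i,j$, all $\gamma\ge\gamma_0$, and all $t$ and $\nu$ as above: for every $\alpha$-stable $\nu$-parabolic $\phi$-connection $(E_1,E_2,\phi,\nabla,l^{(1)}_*,l^{(2)}_*)$ of rank $3$ and degree $-2$ over $(\mathbb{P}^1,t)$ one has $$E_1\cong E_2\cong\mathcal{O}_{\mathbb{P}^1}\oplus\mathcal{O}_{\mathbb{P}^1}(-1)\oplus\mathcal{O}_{\mathbb{P}^1}(-1),$$ and consequently each of $E_1$ and $E_2$ has a unique subbundle isomorphic to $\mathcal{O}_{\mathbb{P}^1}$. -/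

import Mathlib

open Polynomial WithZero
open scoped OnePoint

noncomputable section

namespace PhiConn

/-! ### The projective line over `ℂ`: function field, points, local rings -/

/-- The function field `ℂ(z)` of the projective line. -/
abbrev FunField : Type := RatFunc ℂ

/-- The closed points of the projective line over `ℂ`. -/
abbrev P1 : Type := OnePoint ℂ

/-- The maximal ideal `(z - a)` of `ℂ[z]`. -/
def finitePlace (a : ℂ) : IsDedekindDomain.HeightOneSpectrum ℂ[X] where
  asIdeal := Ideal.span {X - C a}
  isPrime := (Ideal.span_singleton_prime (X_sub_C_ne_zero a)).2 (prime_X_sub_C a)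
  ne_bot := by
    rw [Ne, Ideal.span_singleton_eq_bot]
    exact X_sub_C_ne_zero a

open scoped Classical in
/-- The normalised multiplicative valuation of `ℂ(z)` at a point `p`: a function vanishing to
order `n` at `p` has value `exp (-n)`. -/
def placeVal : P1 → Valuation FunField ℤᵐ⁰
  | ∞ => RatFunc.inftyValuation ℂ
  | OnePoint.some a => (finitePlace a).valuation FunField

/-- The local ring of the projective line at `p`: the rational functions regular at `p`. -/
abbrev localRing (p : P1) : ValuationSubring FunField := (placeVal p).valuationSubring

instance (p : P1) : Algebra (localRing p) FunField :=
  inferInstanceAs (Algebra (localRing p) FunField)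

instance (p : P1) : SMul (localRing p) FunField := Algebra.toSMul

instance (p : P1) (V : Type*) [AddCommGroup V] [Module FunField V] :
    IsScalarTower (localRing p) FunField V :=
  ⟨fun a b c => by
    change ((a : FunField) * b) • c = (a : FunField) • b • c
    rw [mul_smul]⟩

instance (p : P1) (V : Type*) [AddCommGroup V] [Module FunField V] :
    Module.IsTorsionFree (localRing p) V :=
  .trans_faithfulSMul _ FunField _

instance (p : P1) : (placeVal p).IsNontrivial := by
  classical
  induction p using OnePoint.rec with
  | infty => exact inferInstanceAs (RatFunc.inftyValuation ℂ).IsNontrivial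
  | coe a =>
    obtain ⟨x, hx⟩ := (finitePlace a).valuation_exists_uniformizer FunField
    refine ⟨x, ?_, ?_⟩
    · change (finitePlace a).valuation FunField x ≠ 0
      rw [hx]; simp
    · change (finitePlace a).valuation FunField x ≠ 1
      rw [hx]; simp

instance (p : P1) : IsPrincipalIdealRing (localRing p) :=
  Valuation.valuationSubring_isPrincipalIdealRing (placeVal p)

theorem finitePlace_injective : Function.Injective finitePlace := by
  intro a b h
  have h1 : Ideal.span {X - C a} = Ideal.span {X - C b} :=
    congrArg IsDedekindDomain.HeightOneSpectrum.asIdeal h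
  rw [Ideal.span_singleton_eq_span_singleton] at h1
  have h2 : (X - C b : ℂ[X]) ∣ X - C a := h1.symm.dvd
  rw [dvd_iff_isRoot] at h2
  have h3 : b - a = 0 := by simpa using h2
  exact (sub_eq_zero.1 h3).symm

/-- A rational function has finitely many poles. -/
theorem finite_poles (f : FunField) : {p : P1 | f ∉ localRing p}.Finite := by
  have h := (IsDedekindDomain.HeightOneSpectrum.Support.finite ℂ[X] f).preimage
    (finitePlace_injective.injOn)
  refine ((h.image (fun a : ℂ => (a : P1))).union (Set.finite_singleton (∞ : P1))).subset ?_
  intro p hp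
  induction p using OnePoint.rec with
  | infty => exact Or.inr rfl
  | coe a =>
    refine Or.inl ⟨a, ?_, rfl⟩
    exact not_le.1 (show ¬ (finitePlace a).valuation FunField f ≤ 1 from hp)

theorem constant_mem (p : P1) (c : ℂ) : algebraMap ℂ FunField c ∈ localRing p := by
  classical
  induction p using OnePoint.rec with
  | infty =>
    rcases eq_or_ne c 0 with rfl | hc
    · rw [map_zero]; exact zero_mem _
    · exact (RatFunc.inftyValuation.C ℂ hc).le
  | coe a =>
    have : algebraMap ℂ FunField c = algebraMap ℂ[X] FunField (C c) := by
      simp [RatFunc.algebraMap_eq_C]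
    rw [this]
    exact (finitePlace a).valuation_le_one _

/-- The constants `ℂ` inside the local ring at `p`. -/
def constants (p : P1) : ℂ →+* localRing p where
  toFun c := ⟨algebraMap ℂ FunField c, constant_mem p c⟩
  map_one' := Subtype.ext (map_one _)
  map_mul' _ _ := Subtype.ext (map_mul _ _ _)
  map_zero' := Subtype.ext (map_zero _)
  map_add' _ _ := Subtype.ext (map_add _ _ _)

/-- The derivative `df/dz` of a rational function, by the quotient rule. -/
def derivZ (f : FunField) : FunField :=
  algebraMap ℂ[X] FunField
      (derivative f.num * f.denom - f.num * derivative f.denom) /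
    algebraMap ℂ[X] FunField (f.denom ^ 2)

/-! ### Vector bundles on the projective line -/

/-- The module generated by a family of vectors over the local ring at `p`. -/
def localSpan (p : P1) {V ι : Type*} [AddCommGroup V] [Module FunField V] (e : ι → V) :
    Submodule (localRing p) V :=
  Submodule.span (localRing p) (Set.range e)

/-- An algebraic vector bundle on the projective line with generic fibre `V`, seen as a locally
free subsheaf of the constant sheaf `V`. It is given by its stalks: a free
`𝒪_p`-lattice of `V` at every point `p`, such that some basis of `V` is a local frame at all but
finitely many points. The sections over a Zariski open `U` are the elements of `V` that lie in
the stalk at every point of `U`. -/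
structure VectorBundle (V : Type*) [AddCommGroup V] [Module FunField V] where
  stalk : ∀ p : P1, Submodule (localRing p) V
  exists_frame : ∀ p, ∃ e : Module.Basis (Fin (Module.finrank FunField V)) FunField V,
    stalk p = localSpan p e
  exists_generic_frame : ∃ b : Module.Basis (Fin (Module.finrank FunField V)) FunField V,
    {p | stalk p ≠ localSpan p b}.Finite

section Frames

variable {V : Type*} [AddCommGroup V] [Module FunField V]

theorem localSpan_reindex (p : P1) {ι κ : Type*} (e : ι ≃ κ) (b : ι → V) :
    localSpan p (b ∘ e.symm) = localSpan p b := by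
  simp [localSpan, Set.range_comp]

theorem exists_fin_basis {ι : Type*} [Finite ι] (b : Module.Basis ι FunField V) :
    ∃ e : Module.Basis (Fin (Module.finrank FunField V)) FunField V,
      ∀ p, localSpan p e = localSpan p b := by
  classical
  have := Fintype.ofFinite ι
  have h : Fintype.card ι = Module.finrank FunField V :=
    (Module.finrank_eq_card_basis b).symm
  refine ⟨b.reindex (Fintype.equivFinOfCardEq h), fun p => ?_⟩
  rw [← localSpan_reindex p (Fintype.equivFinOfCardEq h) b]
  congr 1
  ext i
  simp

theorem finite_not_localSpan_le {ι κ : Type*} [Finite ι] [Finite κ]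
    (b : ι → V) (c : Module.Basis κ FunField V) :
    {p | ¬ localSpan p b ≤ localSpan p c}.Finite := by
  classical
  have := Fintype.ofFinite κ
  have h : (⋃ i : ι, ⋃ j : κ, {p : P1 | c.repr (b i) j ∉ localRing p}).Finite :=
    Set.finite_iUnion fun i => Set.finite_iUnion fun j => finite_poles _
  refine h.subset fun p hp => ?_
  by_contra hcon
  simp only [Set.mem_iUnion, Set.mem_ofPred_eq, not_exists, not_not] at hcon
  refine hp (Submodule.span_le.2 ?_)
  rintro _ ⟨i, rfl⟩
  rw [← c.sum_repr (b i)]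
  refine Submodule.sum_mem _ fun j _ => ?_
  exact Submodule.smul_mem (localSpan p c) (⟨_, hcon i j⟩ : localRing p)
    (Submodule.subset_span ⟨j, rfl⟩)

theorem finite_localSpan_ne {ι κ : Type*} [Finite ι] [Finite κ]
    (b : Module.Basis ι FunField V) (c : Module.Basis κ FunField V) :
    {p | localSpan p b ≠ localSpan p c}.Finite := by
  refine ((finite_not_localSpan_le b c).union (finite_not_localSpan_le c b)).subset ?_
  intro p hp
  by_contra hcon
  simp only [Set.mem_union, Set.mem_ofPred_eq, not_or, not_not] at hcon
  exact hp (le_antisymm hcon.1 hcon.2)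

end Frames

namespace VectorBundle

variable {V V' : Type*} [AddCommGroup V] [Module FunField V] [AddCommGroup V']
  [Module FunField V']

/-- The rank of a vector bundle. -/
def rank (_E : VectorBundle V) : ℕ := Module.finrank FunField V

/-- The degree of a vector bundle: with `b` a basis of the generic fibre and `e p` a frame of
the stalk at `p`, the degree of the divisor `- ∑ ord_p (det_b (e p)) • p` of the rational section
of the determinant bundle given by `b`. (Recall that `placeVal p f = exp (- ord_p f)`.) -/
def degree (E : VectorBundle V) : ℤ :=
  ∑ᶠ p : P1, log (placeVal p (E.exists_generic_frame.choose.det (E.exists_frame p).choose))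

/-- An isomorphism of vector bundles. -/
structure Iso (E : VectorBundle V) (E' : VectorBundle V') where
  toEquiv : V ≃ₗ[FunField] V'
  map_stalk : ∀ (p : P1) (v : V), toEquiv v ∈ E'.stalk p ↔ v ∈ E.stalk p

/-- The stalk at `p` of the subbundle with generic fibre `W`. -/
def subStalk (E : VectorBundle V) (W : Submodule FunField V) (p : P1) :
    Submodule (localRing p) W where
  carrier := {w | (w : V) ∈ E.stalk p}
  add_mem' := fun ha hb => (E.stalk p).add_mem ha hb
  zero_mem' := (E.stalk p).zero_mem
  smul_mem' := fun r _ hw => (E.stalk p).smul_mem r hw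

theorem exists_frame_sub (E : VectorBundle V) (W : Submodule FunField V) (p : P1) :
    ∃ e : Module.Basis (Fin (Module.finrank FunField W)) FunField W,
      E.subStalk W p = localSpan p e := by
  classical
  obtain ⟨b, hb⟩ := E.exists_frame p
  have : IsNoetherian (localRing p) (E.stalk p) := by
    rw [hb]
    exact isNoetherian_span_of_finite _ (Set.finite_range _)
  let ι : E.subStalk W p →ₗ[localRing p] E.stalk p :=
    { toFun := fun w => ⟨((w : W) : V), w.2⟩
      map_add' := fun _ _ => rfl
      map_smul' := fun _ _ => rfl }
  have hι : Function.Injective ι := by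
    intro x y hxy
    exact Subtype.ext (Subtype.ext (show ((x : W) : V) = ((y : W) : V) from
      congrArg (fun u : E.stalk p => (u : V)) hxy))
  have : IsNoetherian (localRing p) (E.subStalk W p) := isNoetherian_of_injective ι hι
  have : Module.Free (localRing p) (E.subStalk W p) := Module.free_of_finite_type_torsion_free'
  let c := Module.Free.chooseBasis (localRing p) (E.subStalk W p)
  let w : Module.Free.ChooseBasisIndex (localRing p) (E.subStalk W p) → W := fun i => (c i : W)
  have hspan : localSpan p w = E.subStalk W p := by
    have h1 := congrArg (Submodule.map (E.subStalk W p).subtype) c.span_eq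
    rw [Submodule.map_span, Submodule.map_top, Submodule.range_subtype, ← Set.range_comp] at h1
    exact h1
  have hli : LinearIndependent (localRing p) w :=
    c.linearIndependent.map' (E.subStalk W p).subtype (Submodule.ker_subtype _)
  rw [LinearIndependent.iff_fractionRing (localRing p) FunField] at hli
  have htop : ⊤ ≤ Submodule.span FunField (Set.range w) := by
    intro x _
    obtain ⟨d, hd⟩ := IsLocalization.exist_integer_multiples_of_finite
      (nonZeroDivisors (localRing p)) (fun i => b.repr (x : V) i)
    have hx : (d : localRing p) • x ∈ E.subStalk W p := by
      change (d : localRing p) • (x : V) ∈ E.stalk p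
      rw [← b.sum_repr (x : V), Finset.smul_sum, hb]
      refine Submodule.sum_mem _ fun i _ => ?_
      obtain ⟨y, hy⟩ := hd i
      rw [← smul_assoc, ← hy]
      change y • b i ∈ _
      exact Submodule.smul_mem _ _ (Submodule.subset_span ⟨i, rfl⟩)
    rw [← hspan] at hx
    have hx' : (d : localRing p) • x ∈ Submodule.span FunField (Set.range w) :=
      Submodule.span_le_restrictScalars (localRing p) FunField _ hx
    have hd0 : ((d : localRing p) : FunField) ≠ 0 := by
      simp
    exact (Submodule.smul_mem_iff _ hd0).1 hx'
  obtain ⟨e, he⟩ := exists_fin_basis (Module.Basis.mk hli htop)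
  refine ⟨e, ?_⟩
  rw [he, Module.Basis.coe_mk]
  exact hspan.symm

theorem exists_generic_frame_sub (E : VectorBundle V) (W : Submodule FunField V) :
    ∃ e : Module.Basis (Fin (Module.finrank FunField W)) FunField W,
      {p | E.subStalk W p ≠ localSpan p e}.Finite := by
  classical
  obtain ⟨b, hb⟩ := E.exists_generic_frame
  have : Module.Finite FunField V := Module.Finite.of_basis b
  obtain ⟨W', hW'⟩ := W.exists_isCompl
  let c := Module.finBasis FunField W
  let c' := Module.finBasis FunField W'
  let B : Module.Basis (_ ⊕ _) FunField V :=
    (c.prod c').map (Submodule.prodEquivOfIsCompl W W' hW')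
  have hBl : ∀ i, B (Sum.inl i) = (c i : V) := fun i => by simp [B]
  have hBr : ∀ i, B (Sum.inr i) = (c' i : V) := fun i => by simp [B]
  refine ⟨c, (hb.union (finite_localSpan_ne b B)).subset ?_⟩
  intro p hp
  by_contra hcon
  simp only [Set.mem_union, Set.mem_ofPred_eq, not_or, not_not] at hcon
  have hE : E.stalk p = localSpan p B := hcon.1.trans hcon.2
  apply hp
  ext x
  change (x : V) ∈ E.stalk p ↔ _
  rw [hE]
  constructor
  · intro hx
    obtain ⟨r, hr⟩ := (Submodule.mem_span_range_iff_exists_fun (localRing p)).1 hx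
    have hrepr : (x : V) = ∑ i, r (Sum.inl i) • (c i : V) + ∑ i, r (Sum.inr i) • (c' i : V) := by
      rw [← hr, Fintype.sum_sum_type]
      simp only [hBl, hBr]
    have hmemW : ∑ i, r (Sum.inl i) • (c i : V) ∈ W :=
      Submodule.sum_mem _ fun i _ => W.smul_mem (r (Sum.inl i) : FunField) (c i).2
    have hmemW' : ∑ i, r (Sum.inr i) • (c' i : V) ∈ W' :=
      Submodule.sum_mem _ fun i _ => W'.smul_mem (r (Sum.inr i) : FunField) (c' i).2
    have hz : ∑ i, r (Sum.inr i) • (c' i : V) = 0 := by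
      refine Submodule.disjoint_def.1 hW'.disjoint _ ?_ hmemW'
      have := W.sub_mem x.2 hmemW
      rwa [hrepr, add_sub_cancel_left] at this
    rw [hz, add_zero] at hrepr
    refine (Submodule.mem_span_range_iff_exists_fun (localRing p)).2 ⟨fun i => r (Sum.inl i), ?_⟩
    apply Subtype.ext
    rw [hrepr, Submodule.coe_sum]
    rfl
  · intro hx
    obtain ⟨r, hr⟩ := (Submodule.mem_span_range_iff_exists_fun (localRing p)).1 hx
    rw [← hr, Submodule.coe_sum]
    refine Submodule.sum_mem _ fun i _ => ?_
    change r i • (c i : V) ∈ _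
    rw [← hBl]
    exact Submodule.smul_mem _ _ (Submodule.subset_span ⟨_, rfl⟩)

/-- The subbundle of `E` with generic fibre `W`. Subbundles of `E` (subsheaves with locally free
quotient) correspond bijectively to subspaces `W` of the generic fibre: the stalk of the
subbundle at `p` is `W ∩ E_p`. -/
def sub (E : VectorBundle V) (W : Submodule FunField V) : VectorBundle W where
  stalk := E.subStalk W
  exists_frame := E.exists_frame_sub W
  exists_generic_frame := E.exists_generic_frame_sub W

theorem localSpan_prod {ι κ : Type*} (p : P1) (b : Module.Basis ι FunField V)
    (b' : Module.Basis κ FunField V') :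
    localSpan p (b.prod b') = (localSpan p b).prod (localSpan p b') := by
  have hl : ∀ i, b.prod b' (Sum.inl i) = (b i, 0) := fun i => by
    ext <;> simp
  have hr : ∀ i, b.prod b' (Sum.inr i) = (0, b' i) := fun i => by
    ext <;> simp
  apply le_antisymm
  · refine Submodule.span_le.2 ?_
    rintro _ ⟨i | i, rfl⟩
    · rw [hl]
      exact ⟨Submodule.subset_span ⟨i, rfl⟩, Submodule.zero_mem _⟩
    · rw [hr]
      exact ⟨Submodule.zero_mem _, Submodule.subset_span ⟨i, rfl⟩⟩
  · rintro ⟨x, y⟩ ⟨hx, hy⟩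
    have h1 : localSpan p b ≤ (localSpan p (b.prod b')).comap (LinearMap.inl _ V V') := by
      refine Submodule.span_le.2 ?_
      rintro _ ⟨i, rfl⟩
      exact Submodule.subset_span ⟨Sum.inl i, hl i⟩
    have h2 : localSpan p b' ≤ (localSpan p (b.prod b')).comap (LinearMap.inr _ V V') := by
      refine Submodule.span_le.2 ?_
      rintro _ ⟨i, rfl⟩
      exact Submodule.subset_span ⟨Sum.inr i, hr i⟩
    have h3 : (x, 0) + (0, y) ∈ localSpan p (b.prod b') := Submodule.add_mem _ (h1 hx) (h2 hy)
    simpa using h3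

/-- The direct sum of two vector bundles. -/
def prod (E : VectorBundle V) (E' : VectorBundle V') : VectorBundle (V × V') where
  stalk p := (E.stalk p).prod (E'.stalk p)
  exists_frame p := by
    obtain ⟨b, hb⟩ := E.exists_frame p
    obtain ⟨b', hb'⟩ := E'.exists_frame p
    obtain ⟨e, he⟩ := exists_fin_basis (b.prod b')
    exact ⟨e, by rw [he, localSpan_prod, hb, hb']⟩
  exists_generic_frame := by
    obtain ⟨b, hb⟩ := E.exists_generic_frame
    obtain ⟨b', hb'⟩ := E'.exists_generic_frame
    obtain ⟨e, he⟩ := exists_fin_basis (b.prod b')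
    refine ⟨e, (hb.union hb').subset fun p hp => ?_⟩
    by_contra hcon
    simp only [Set.mem_union, Set.mem_ofPred_eq, not_or, not_not] at hcon
    exact hp (by rw [he, localSpan_prod, hcon.1, hcon.2])

end VectorBundle

/-- The bound on the valuation at `p` of sections of `𝒪(n) = 𝒪(n · ∞)`. -/
def poleBound (n : ℤ) : P1 → ℤᵐ⁰
  | ∞ => exp n
  | OnePoint.some _ => 1

/-- The stalks of `𝒪(n)`. -/
def lineStalk (n : ℤ) (p : P1) : Submodule (localRing p) FunField where
  carrier := {f | placeVal p f ≤ poleBound n p}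
  add_mem' := fun ha hb => ((placeVal p).map_add _ _).trans (max_le ha hb)
  zero_mem' := by simp
  smul_mem' := fun r f hf => by
    change placeVal p ((r : FunField) * f) ≤ poleBound n p
    rw [map_mul]
    exact (mul_le_of_le_one_left' (show placeVal p (r : FunField) ≤ 1 from r.2)).trans hf

theorem lineStalk_eq_localSpan (n : ℤ) (p : P1) (g : FunField) (hg : g ≠ 0)
    (h : placeVal p g = poleBound n p) : lineStalk n p = localSpan p (fun _ : Unit => g) := by
  ext f
  rw [localSpan, Set.range_const, Submodule.mem_span_singleton]
  change placeVal p f ≤ poleBound n p ↔ _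
  have hg0 : placeVal p g ≠ 0 := (placeVal p).ne_zero_iff.2 hg
  constructor
  · intro hf
    refine ⟨⟨f / g, ?_⟩, ?_⟩
    · change placeVal p (f / g) ≤ 1
      rw [map_div₀]
      exact div_le_one_of_le₀ (by rwa [h]) (zero_le)
    · change f / g * g = f
      exact div_mul_cancel₀ f hg
  · rintro ⟨r, rfl⟩
    change placeVal p ((r : FunField) * g) ≤ poleBound n p
    rw [map_mul, ← h]
    exact mul_le_of_le_one_left' r.2

/-- The basis of the function field, as a vector space over itself, given by `g ≠ 0`. -/
def unitBasis (g : FunField) (hg : g ≠ 0) : Module.Basis Unit FunField FunField :=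
  (Module.Basis.singleton Unit FunField).unitsSMul fun _ => Units.mk0 g hg

theorem coe_unitBasis (g : FunField) (hg : g ≠ 0) : ⇑(unitBasis g hg) = fun _ => g := by
  ext1 i
  simp [unitBasis, Module.Basis.unitsSMul_apply, Units.smul_def]

/-- The line bundle `𝒪(n)`, realised as `𝒪(n · ∞)`: its sections are the rational functions that
are regular away from `∞` and have a pole of order at most `n` at `∞`. -/
def lineBundle (n : ℤ) : VectorBundle FunField where
  stalk := lineStalk n
  exists_frame p := by
    classical
    induction p using OnePoint.rec with
    | infty =>
      have hX : (RatFunc.X ^ n : FunField) ≠ 0 := zpow_ne_zero _ RatFunc.X_ne_zero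
      obtain ⟨e, he⟩ := exists_fin_basis (unitBasis _ hX)
      refine ⟨e, ?_⟩
      rw [he, coe_unitBasis]
      refine lineStalk_eq_localSpan n _ _ hX ?_
      exact RatFunc.inftyValuation.X_zpow ℂ n
    | coe a =>
      obtain ⟨e, he⟩ := exists_fin_basis (unitBasis 1 one_ne_zero)
      refine ⟨e, ?_⟩
      rw [he, coe_unitBasis]
      refine lineStalk_eq_localSpan n _ _ one_ne_zero ?_
      exact map_one _
  exists_generic_frame := by
    obtain ⟨e, he⟩ := exists_fin_basis (unitBasis 1 one_ne_zero)
    refine ⟨e, (Set.finite_singleton (∞ : P1)).subset fun p hp => ?_⟩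
    induction p using OnePoint.rec with
    | infty => rfl
    | coe a =>
      refine (hp ?_).elim
      rw [he, coe_unitBasis]
      refine lineStalk_eq_localSpan n _ _ one_ne_zero ?_
      exact map_one _

namespace VectorBundle

variable {V V' : Type*} [AddCommGroup V] [Module FunField V] [AddCommGroup V']
  [Module FunField V']

/-! ### Fibres and homomorphisms -/

/-- The fibre `E|_p = E_p / 𝔪_p E_p`. -/
def Fibre (E : VectorBundle V) (p : P1) : Type _ :=
  E.stalk p ⧸ (IsLocalRing.maximalIdeal (localRing p) • (⊤ : Submodule (localRing p) (E.stalk p)))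

instance (E : VectorBundle V) (p : P1) : AddCommGroup (E.Fibre p) :=
  inferInstanceAs (AddCommGroup (E.stalk p ⧸
    (IsLocalRing.maximalIdeal (localRing p) • (⊤ : Submodule (localRing p) (E.stalk p)))))

instance (E : VectorBundle V) (p : P1) : Module (localRing p) (E.Fibre p) :=
  inferInstanceAs (Module (localRing p) (E.stalk p ⧸
    (IsLocalRing.maximalIdeal (localRing p) • (⊤ : Submodule (localRing p) (E.stalk p)))))

/-- The fibres are complex vector spaces. -/
instance (E : VectorBundle V) (p : P1) : Module ℂ (E.Fibre p) :=
  Module.compHom _ (constants p)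

/-- The value at `p` of a germ of a section. -/
def toFibre (E : VectorBundle V) (p : P1) : E.stalk p →ₗ[localRing p] E.Fibre p :=
  Submodule.mkQ _

/-- The fibre at `p` of the subbundle with generic fibre `W`, as a subspace of the fibre
of `E`. -/
def subFibre (E : VectorBundle V) (W : Submodule FunField V) (p : P1) :
    Submodule ℂ (E.Fibre p) where
  carrier := {x | ∃ v : E.stalk p, (v : V) ∈ W ∧ E.toFibre p v = x}
  add_mem' := by
    rintro _ _ ⟨v, hv, rfl⟩ ⟨w, hw, rfl⟩
    exact ⟨v + w, W.add_mem hv hw, map_add _ _ _⟩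
  zero_mem' := ⟨0, W.zero_mem, map_zero _⟩
  smul_mem' := by
    rintro c _ ⟨v, hv, rfl⟩
    exact ⟨constants p c • v, W.smul_mem (constants p c : FunField) hv, map_smul _ _ _⟩

/-- A homomorphism of vector bundles (as `𝒪`-modules). -/
structure Hom (E : VectorBundle V) (E' : VectorBundle V') where
  toLinearMap : V →ₗ[FunField] V'
  map_stalk : ∀ (p : P1), ∀ v ∈ E.stalk p, toLinearMap v ∈ E'.stalk p

/-- The map induced by a homomorphism on stalks. -/
def Hom.stalkMap {E : VectorBundle V} {E' : VectorBundle V'} (φ : Hom E E') (p : P1) :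
    E.stalk p →ₗ[localRing p] E'.stalk p where
  toFun v := ⟨φ.toLinearMap v, φ.map_stalk p v v.2⟩
  map_add' _ _ := Subtype.ext (map_add _ _ _)
  map_smul' r v := Subtype.ext (φ.toLinearMap.map_smul (r : FunField) (v : V))

/-- The `ℂ`-linear map `φ_p` induced by a homomorphism on fibres. -/
def Hom.fibreMap {E : VectorBundle V} {E' : VectorBundle V'} (φ : Hom E E') (p : P1) :
    E.Fibre p →ₗ[ℂ] E'.Fibre p :=
  let f : E.Fibre p →ₗ[localRing p] E'.Fibre p :=
    Submodule.mapQ _ _ (φ.stalkMap p) (by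
      rw [← Submodule.map_le_iff_le_comap, Submodule.map_smul'']
      exact Submodule.smul_mono le_rfl le_top)
  { toFun := f
    map_add' := f.map_add
    map_smul' := fun c x => f.map_smul (constants p c) x }

/-- A complete flag `E|_p = l 0 ⊋ l 1 ⊋ ⋯ ⊋ l r = 0` of the fibre at `p` (of dimension `r`). -/
structure Flag (E : VectorBundle V) (p : P1) (r : ℕ) where
  l : Fin (r + 1) → Submodule ℂ (E.Fibre p)
  strictAnti : StrictAnti l
  zero_eq : l 0 = ⊤
  last_eq : l (Fin.last r) = ⊥

/-- For `j = 0, …, r - 1`, the dimension of `(F|_p ∩ l j) / (F|_p ∩ l (j + 1))`, where `F` is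
the subbundle with generic fibre `W`. -/
def Flag.jump {E : VectorBundle V} {p : P1} {r : ℕ} (L : Flag E p r) (W : Submodule FunField V)
    (j : Fin r) : ℕ :=
  Module.finrank ℂ
    (↥(E.subFibre W p ⊓ L.l j.castSucc) ⧸
      (E.subFibre W p ⊓ L.l j.succ).submoduleOf (E.subFibre W p ⊓ L.l j.castSucc))

end VectorBundle

/-! ### Logarithmic `φ`-connections

Differential forms with values in a bundle are written `u dz` with `u` in the generic fibre.
At `a ∈ ℂ` the form `u dz` equals `((z - a) u) d(z - a) / (z - a)`, and at `∞`, in the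
coordinate `w = 1 / z`, one has `u dz = (- z ^ 2 u) dw = (- z u) dw / w`. -/

/-- The factor `c` with `u dz = (c u) dx` for the local coordinate `x` at `p`
(`x = z - a` at `a`, and `x = 1 / z` at `∞`). -/
def regCoeff : P1 → FunField
  | ∞ => -RatFunc.X ^ 2
  | OnePoint.some _ => 1

/-- The factor `c` with `u dz = (c u) dx / x` for the local coordinate `x` at `p`. Thus `u dz` has
at most a logarithmic pole at `p` if and only if `c u` is in the stalk at `p`, and then its
residue is the value of `c u` at `p`. -/
def logCoeff : P1 → FunField
  | ∞ => -RatFunc.X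
  | OnePoint.some a => RatFunc.X - RatFunc.C a

section Connections

variable {V₁ V₂ : Type*} [AddCommGroup V₁] [Module FunField V₁] [AddCommGroup V₂]
  [Module FunField V₂] {n : ℕ}

/-- A logarithmic `φ`-connection `∇ : E₁ → E₂ ⊗ Ω¹(t₁ + ⋯ + tₙ)`. On the generic fibre,
`∇ v = (toFun v) dz`. -/
structure LogConnection (t : Fin n → P1) {E₁ : VectorBundle V₁} {E₂ : VectorBundle V₂}
    (φ : VectorBundle.Hom E₁ E₂) where
  toFun : V₁ →+ V₂
  leibniz : ∀ (f : FunField) (v : V₁),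
    toFun (f • v) = derivZ f • φ.toLinearMap v + f • toFun v
  regular : ∀ p ∉ Set.range t, ∀ v ∈ E₁.stalk p, regCoeff p • toFun v ∈ E₂.stalk p
  log_pole : ∀ i, ∀ v ∈ E₁.stalk (t i), logCoeff (t i) • toFun v ∈ E₂.stalk (t i)

/-- The residue `res_{t i} ∇` applied to the value at `t i` of the germ `v`. -/
def LogConnection.res {t : Fin n → P1} {E₁ : VectorBundle V₁} {E₂ : VectorBundle V₂}
    {φ : VectorBundle.Hom E₁ E₂} (D : LogConnection t φ) (i : Fin n) (v : E₁.stalk (t i)) :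
    E₂.Fibre (t i) :=
  E₂.toFibre (t i) ⟨logCoeff (t i) • D.toFun v, D.log_pole i v v.2⟩

/-- The local exponents `ν` satisfying the Fuchs relation `∑ ν i j + d = 0`. -/
def localExponents (n r : ℕ) (d : ℤ) : Set (Fin n → Fin r → ℂ) :=
  {ν | ∑ i, ∑ j, ν i j + (d : ℂ) = 0}

/-- A `ν`-parabolic `φ`-connection of rank `r` and degree `d` over `(ℙ¹, t₁, …, tₙ)`, on
bundles with generic fibres `V₁` and `V₂`. -/
structure ParabolicPhiConnection (V₁ V₂ : Type*) [AddCommGroup V₁] [Module FunField V₁]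
    [AddCommGroup V₂] [Module FunField V₂] {n r : ℕ} (d : ℤ) (t : Fin n → P1)
    (ν : Fin n → Fin r → ℂ) where
  E₁ : VectorBundle V₁
  E₂ : VectorBundle V₂
  rank₁ : E₁.rank = r
  rank₂ : E₂.rank = r
  degree₁ : E₁.degree = d
  degree₂ : E₂.degree = d
  l₁ : ∀ i, E₁.Flag (t i) r
  l₂ : ∀ i, E₂.Flag (t i) r
  φ : VectorBundle.Hom E₁ E₂
  φ_flag : ∀ i j, ∀ x ∈ (l₁ i).l j, φ.fibreMap (t i) x ∈ (l₂ i).l j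
  conn : LogConnection t φ
  res_flag : ∀ (i : Fin n) (j : Fin r) (v : E₁.stalk (t i)),
    E₁.toFibre (t i) v ∈ (l₁ i).l j.castSucc →
      conn.res i v - ν i j • φ.fibreMap (t i) (E₁.toFibre (t i) v) ∈ (l₂ i).l j.succ

/-- A parabolic weight: rational numbers `0 < α i 0 < ⋯ < α i (r - 1) < 1` for every `i`, all
distinct. -/
structure IsParabolicWeight {n r : ℕ} (α : Fin n → Fin r → ℚ) : Prop where
  pos : ∀ i j, 0 < α i j
  lt_one : ∀ i j, α i j < 1
  strictMono : ∀ i, StrictMono (α i)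
  distinct : ∀ i j i' j', (i, j) ≠ (i', j') → α i j ≠ α i' j'

namespace ParabolicPhiConnection

variable {r : ℕ} {d : ℤ} {t : Fin n → P1} {ν : Fin n → Fin r → ℂ}

/-- The parabolic slope of the pair of subbundles with generic fibres `W₁` and `W₂`, with the
same weights `α` on `E₁` and `E₂`. -/
def slope (P : ParabolicPhiConnection V₁ V₂ d t ν) (α : Fin n → Fin r → ℚ) (γ : ℕ)
    (W₁ : Submodule FunField V₁) (W₂ : Submodule FunField V₂) : ℚ :=
  (((P.E₁.sub W₁).degree : ℚ) + ((P.E₂.sub W₂).degree - γ * (P.E₂.sub W₂).rank)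
      + ∑ i, ∑ j, α i j * (P.l₁ i).jump W₁ j + ∑ i, ∑ j, α i j * (P.l₂ i).jump W₂ j) /
    ((P.E₁.sub W₁).rank + (P.E₂.sub W₂).rank)

/-- `α`-stability (with parameter `γ`): every pair of subbundles `F₁ ⊆ E₁`, `F₂ ⊆ E₂` other than
`(0, 0)` and `(E₁, E₂)`, with `φ(F₁) ⊆ F₂` and `∇(F₁) ⊆ F₂ ⊗ Ω¹(D)`, has slope smaller than
`(E₁, E₂)`. -/
def IsStable (P : ParabolicPhiConnection V₁ V₂ d t ν) (α : Fin n → Fin r → ℚ) (γ : ℕ) : Prop :=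
  ∀ (W₁ : Submodule FunField V₁) (W₂ : Submodule FunField V₂),
    (W₁, W₂) ≠ (⊥, ⊥) → (W₁, W₂) ≠ (⊤, ⊤) →
    (∀ v ∈ W₁, P.φ.toLinearMap v ∈ W₂) → (∀ v ∈ W₁, P.conn.toFun v ∈ W₂) →
    P.slope α γ W₁ W₂ < P.slope α γ ⊤ ⊤

end ParabolicPhiConnection

end Connections

end PhiConn

end

noncomputable section

namespace PhiConn

/-! ### The product formula and residue fields -/

/-! On `ℙ¹` the splitting type can be read off from degrees of subbundles. Suppose `E` has rank 3
and degree -2, with line subbundles of degree at most 0 and plane subbundles of degree at most -1.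
In a splitting `⨁ 𝒪(m i)` each `m i` is then at most 0 and each sum of two at most -1, so the total
-2 forces `{0, -1, -1}`. Two different copies of `𝒪` would span a plane of degree at least 0.
Everything thus reduces to `SubDegreeBounds` for both bundles.

For small weights the parabolic terms cannot affect an inequality between integers. By
`IsStable.degree_bound` an invariant pair of ranks `(r₁, r₂)` satisfies `6 (d₁ + d₂) + 4 (r₁ + r₂) +
3 γ (r₁ - r₂) ≤ 0`. So `d₁ + d₂` is at most -2 for ranks `(1, 1)`, at most -3 for `(2, 2)`, and at
most -6 whenever `r₁ > r₂` and `γ ≥ 10`.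

Invariant pairs come from `exists_ker_image`. If `φ(W) ⊆ U`, then `∇` induces an `𝒪`-linear map from
`W` to `(E₂ / U) ⊗ Ω¹(D)`, where `Ω¹(D)` has degree 1. With kernel `N` and saturated image `M / U`
this gives `d₁ W - d₁ N ≤ d₂ M - d₂ U + (rk W - rk N)`, and both `(N, U)` and `(W, M)` are
invariant. Combining this with the stability inequalities bounds the degrees. The untwisted version
for `φ` transports bounds between `E₁` and `E₂`. `StableDegrees` isolates these facts, and
`linePlaneBound` concludes by cases on the generic rank of `φ`.

The foundations are the product formula (the degree is independent of frames), additivity of the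
degree in exact sequences, and Grothendieck's splitting theorem `exists_splitting`. -/

theorem placeVal_ne_zero {p : P1} {f : FunField} (hf : f ≠ 0) : placeVal p f ≠ 0 :=
  (placeVal p).ne_zero_iff.2 hf

theorem mem_localRing_iff {p : P1} {f : FunField} : f ∈ localRing p ↔ placeVal p f ≤ 1 := Iff.rfl

/-- The logarithm of the valuation of `f` at `p`, which is minus the order of `f` at `p`. -/
def logVal (p : P1) (f : FunField) : ℤ := log (placeVal p f)

theorem exp_logVal {p : P1} {f : FunField} (hf : f ≠ 0) : exp (logVal p f) = placeVal p f :=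
  exp_log (placeVal_ne_zero hf)

theorem placeVal_le_exp_iff {p : P1} {f : FunField} (hf : f ≠ 0) {n : ℤ} :
    placeVal p f ≤ exp n ↔ logVal p f ≤ n := by
  rw [← exp_logVal hf, exp_le_exp]

theorem placeVal_le_one_iff {p : P1} {f : FunField} (hf : f ≠ 0) :
    placeVal p f ≤ 1 ↔ logVal p f ≤ 0 := by
  rw [← exp_zero, placeVal_le_exp_iff hf]

theorem placeVal_eq_one_iff {p : P1} {f : FunField} (hf : f ≠ 0) :
    placeVal p f = 1 ↔ logVal p f = 0 := by
  rw [← exp_zero, ← exp_logVal hf, exp_inj]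

theorem logVal_mul (p : P1) {f g : FunField} (hf : f ≠ 0) (hg : g ≠ 0) :
    logVal p (f * g) = logVal p f + logVal p g := by
  rw [logVal, map_mul, log_mul (placeVal_ne_zero hf) (placeVal_ne_zero hg), logVal, logVal]

theorem logVal_inv (p : P1) (f : FunField) : logVal p f⁻¹ = - logVal p f := by
  rw [logVal, map_inv₀, log_inv, logVal]

theorem logVal_one (p : P1) : logVal p 1 = 0 := by
  rw [logVal, map_one, log_one]

theorem logVal_pow (p : P1) (f : FunField) (n : ℕ) : logVal p (f ^ n) = n * logVal p f := by
  rw [logVal, map_pow, log_pow, nsmul_eq_mul, logVal]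

theorem logVal_neg (p : P1) (f : FunField) : logVal p (-f) = logVal p f := by
  rw [logVal, Valuation.map_neg, logVal]

theorem finite_support_logVal (f : FunField) : (Function.support fun p => logVal p f).Finite := by
  rcases eq_or_ne f 0 with rfl | hf
  · have : (Function.support fun p => logVal p (0 : FunField)) = ∅ := by
      ext p; simp [logVal]
    rw [this]; exact Set.finite_empty
  refine ((finite_poles f).union (finite_poles f⁻¹)).subset fun p hp => ?_
  by_contra hcon
  simp only [Set.mem_union, Set.mem_ofPred_eq, not_or, not_not, mem_localRing_iff] at hcon
  rw [placeVal_le_one_iff hf, placeVal_le_one_iff (inv_ne_zero hf), logVal_inv] at hcon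
  exact hp (by change logVal p f = 0; omega)

theorem logVal_C (p : P1) {c : ℂ} (hc : c ≠ 0) : logVal p (RatFunc.C c) = 0 := by
  have h1 := constant_mem p c
  have h2 := constant_mem p c⁻¹
  rw [← RatFunc.algebraMap_eq_C]
  have h0 : algebraMap ℂ FunField c ≠ 0 := by simpa using hc
  rw [map_inv₀] at h2
  rw [mem_localRing_iff, placeVal_le_one_iff h0] at h1
  rw [mem_localRing_iff, placeVal_le_one_iff (inv_ne_zero h0), logVal_inv] at h2
  exact le_antisymm h1 (neg_nonpos.1 h2)

theorem X_sub_C_ne_zero' (a : ℂ) : (RatFunc.X - RatFunc.C a : FunField) ≠ 0 := by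
  rw [← RatFunc.algebraMap_X, ← RatFunc.algebraMap_C, ← map_sub]
  exact (RatFunc.algebraMap_ne_zero (X_sub_C_ne_zero a))

theorem logVal_infty_algebraMap {q : ℂ[X]} (hq : q ≠ 0) :
    logVal ∞ (algebraMap ℂ[X] FunField q) = q.natDegree := by
  classical
  have := RatFunc.inftyValuation.polynomial ℂ hq
  change log (RatFunc.inftyValuation ℂ _) = _
  rw [RatFunc.inftyValuation_apply]
  convert congrArg log this
  exact (log_exp _).symm

theorem logVal_infty_X_sub_C (a : ℂ) : logVal ∞ (RatFunc.X - RatFunc.C a) = 1 := by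
  rw [← RatFunc.algebraMap_X, ← RatFunc.algebraMap_C, ← map_sub,
    logVal_infty_algebraMap (X_sub_C_ne_zero a), natDegree_X_sub_C, Nat.cast_one]

theorem logVal_infty_X : logVal ∞ (RatFunc.X : FunField) = 1 := by
  simpa using logVal_infty_X_sub_C 0

theorem logVal_coe_X_sub_C (a : ℂ) : logVal (a : P1) (RatFunc.X - RatFunc.C a) = -1 := by
  rw [← RatFunc.algebraMap_X, ← RatFunc.algebraMap_C, ← map_sub]
  change log ((finitePlace a).valuation FunField _) = _
  rw [IsDedekindDomain.HeightOneSpectrum.valuation_of_algebraMap,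
    (finitePlace a).intValuation_singleton (X_sub_C_ne_zero a) rfl, log_exp]

theorem placeVal_coe_algebraMap_eq_one {a : ℂ} {q : ℂ[X]} (hq : q.eval a ≠ 0) :
    placeVal (a : P1) (algebraMap ℂ[X] FunField q) = 1 := by
  change (finitePlace a).valuation FunField _ = _
  rw [IsDedekindDomain.HeightOneSpectrum.valuation_eq_one_iff_notMem]
  change q ∉ Ideal.span {X - C a}
  rw [Ideal.mem_span_singleton, dvd_iff_isRoot]
  exact hq

theorem placeVal_coe_algebraMap_le_one (a : ℂ) (q : ℂ[X]) :
    placeVal (a : P1) (algebraMap ℂ[X] FunField q) ≤ 1 :=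
  (finitePlace a).valuation_le_one _

theorem logVal_coe_X_sub_C_of_ne {a b : ℂ} (h : b ≠ a) :
    logVal (b : P1) (RatFunc.X - RatFunc.C a) = 0 := by
  rw [← placeVal_eq_one_iff (X_sub_C_ne_zero' a), ← RatFunc.algebraMap_X, ← RatFunc.algebraMap_C,
    ← map_sub]
  refine placeVal_coe_algebraMap_eq_one ?_
  simpa [sub_eq_zero] using h

theorem finsum_logVal_X_sub_C (a : ℂ) : ∑ᶠ p : P1, logVal p (RatFunc.X - RatFunc.C a) = 0 := by
  classical
  rw [finsum_eq_sum_of_support_subset (s := {∞, (a : P1)})]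
  · rw [Finset.sum_pair (OnePoint.infty_ne_coe a), logVal_infty_X_sub_C, logVal_coe_X_sub_C]
    norm_num
  · intro p hp
    induction p using OnePoint.rec with
    | infty => simp
    | coe b =>
      by_cases h : b = a
      · simp [h]
      · exact (hp (logVal_coe_X_sub_C_of_ne h)).elim

theorem finsum_logVal_mul {f g : FunField} (hf : f ≠ 0) (hg : g ≠ 0) :
    ∑ᶠ p, logVal p (f * g) = ∑ᶠ p, logVal p f + ∑ᶠ p, logVal p g := by
  rw [← finsum_add_distrib (finite_support_logVal f) (finite_support_logVal g)]
  exact finsum_congr fun p => logVal_mul p hf hg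

/-- Over `ℂ` a nonzero polynomial is a constant times linear factors. Nonzero constants have order
zero everywhere, and the divisor of `X - a` is `(a) - (∞)`. -/
theorem finsum_logVal_algebraMap {q : ℂ[X]} (hq : q ≠ 0) :
    ∑ᶠ p, logVal p (algebraMap ℂ[X] FunField q) = 0 := by
  have key : ∀ s : Multiset ℂ,
      ∑ᶠ p, logVal p (algebraMap ℂ[X] FunField (s.map fun a => X - C a).prod) = 0 := by
    intro s
    induction s using Multiset.induction with
    | empty => simp [logVal_one]
    | cons a s ih =>
      rw [Multiset.map_cons, Multiset.prod_cons, map_mul, finsum_logVal_mul, ih, map_sub,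
        RatFunc.algebraMap_X, RatFunc.algebraMap_C, finsum_logVal_X_sub_C, add_zero]
      · exact RatFunc.algebraMap_ne_zero (X_sub_C_ne_zero a)
      · refine RatFunc.algebraMap_ne_zero (Multiset.prod_ne_zero fun h => ?_)
        obtain ⟨b, -, hb⟩ := Multiset.mem_map.1 h
        exact X_sub_C_ne_zero b hb
  have hs := (IsAlgClosed.splits q).eq_prod_roots
  have hl : q.leadingCoeff ≠ 0 := leadingCoeff_ne_zero.2 hq
  have hC : (RatFunc.C q.leadingCoeff : FunField) ≠ 0 := by
    simpa using hl
  have hp : algebraMap ℂ[X] FunField (q.roots.map fun a => X - C a).prod ≠ 0 := by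
    refine RatFunc.algebraMap_ne_zero fun h => hq ?_
    rw [hs, h, mul_zero]
  rw [hs, map_mul, RatFunc.algebraMap_C, finsum_logVal_mul hC hp, key, add_zero]
  exact finsum_eq_zero_of_forall_eq_zero fun p => logVal_C p hl

/-- The product formula. -/
theorem finsum_logVal {f : FunField} (hf : f ≠ 0) : ∑ᶠ p, logVal p f = 0 := by
  have hd := RatFunc.algebraMap_ne_zero (RatFunc.denom_ne_zero f)
  have hn := RatFunc.algebraMap_ne_zero (RatFunc.num_ne_zero hf)
  have h := RatFunc.num_div_denom f
  rw [div_eq_iff hd] at h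
  have h2 := finsum_logVal_mul hf hd
  rw [← h, finsum_logVal_algebraMap (RatFunc.num_ne_zero hf),
    finsum_logVal_algebraMap (RatFunc.denom_ne_zero f), add_zero] at h2
  exact h2.symm

/-- The residue field at every point is `ℂ`. -/
theorem exists_constant_sub_lt_one {p : P1} {f : FunField} (hf : f ∈ localRing p) :
    ∃ c : ℂ, placeVal p (f - algebraMap ℂ FunField c) < 1 := by
  classical
  induction p using OnePoint.rec with
  | coe a =>
    obtain ⟨q, hq⟩ := (finitePlace a).exists_valuation_sub_lt_of_integer hf 1
    refine ⟨q.eval a, ?_⟩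
    have h1 : placeVal (a : P1) (algebraMap ℂ[X] FunField (q - C (q.eval a))) < 1 := by
      refine ((finitePlace a).valuation_lt_one_iff_mem _).2 ?_
      change _ ∈ Ideal.span {X - C a}
      rw [Ideal.mem_span_singleton, dvd_iff_isRoot]
      simp
    have h2 : f - algebraMap ℂ FunField (q.eval a) =
        algebraMap ℂ[X] FunField (q - C (q.eval a)) - (algebraMap ℂ[X] FunField q - f) := by
      rw [map_sub, RatFunc.algebraMap_C, RatFunc.algebraMap_eq_C]; ring
    rw [h2]
    exact (Valuation.map_sub _ _ _).trans_lt (max_lt h1 hq)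
  | infty =>
    rcases eq_or_ne f 0 with rfl | hf0
    · exact ⟨0, by simp⟩
    rw [mem_localRing_iff, placeVal_le_one_iff hf0] at hf
    rcases hf.lt_or_eq with h | h
    · refine ⟨0, ?_⟩
      rw [map_zero, sub_zero, ← exp_logVal hf0, ← exp_zero, exp_lt_exp]
      exact h
    have hd := RatFunc.denom_ne_zero f
    have hn := RatFunc.num_ne_zero hf0
    have hd' := RatFunc.algebraMap_ne_zero hd
    have hfe := RatFunc.num_div_denom f
    have hdeg : f.num.natDegree = f.denom.natDegree := by
      rw [div_eq_iff hd'] at hfe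
      have := logVal_mul ∞ hf0 hd'
      rw [← hfe, logVal_infty_algebraMap hn, logVal_infty_algebraMap hd, h, zero_add] at this
      exact_mod_cast this
    -- The value of `f` at `∞`: numerator and denominator have the same degree, so subtracting `c`
    -- times the denominator cancels the leading term.
    set c := f.num.leadingCoeff / f.denom.leadingCoeff with hc
    have hl : f.denom.leadingCoeff ≠ 0 := leadingCoeff_ne_zero.2 hd
    refine ⟨c, ?_⟩
    have hfc : f - algebraMap ℂ FunField c =
        algebraMap ℂ[X] FunField (f.num - C c * f.denom) / algebraMap ℂ[X] FunField f.denom := by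
      rw [map_sub, map_mul, sub_div, hfe, mul_div_cancel_right₀ _ hd', RatFunc.algebraMap_C,
        RatFunc.algebraMap_eq_C]
    rw [hfc]
    rcases eq_or_ne (f.num - C c * f.denom) 0 with h0 | h0
    · rw [h0]; simp
    have hlt : (f.num - C c * f.denom).natDegree < f.denom.natDegree := by
      have h1 : (f.num - C c * f.denom).natDegree ≤ f.denom.natDegree := by
        refine (natDegree_sub_le _ _).trans (max_le hdeg.le ?_)
        exact natDegree_C_mul_le _ _
      refine lt_of_le_of_ne h1 fun h2 => h0 ?_
      rw [← leadingCoeff_eq_zero, leadingCoeff, h2, coeff_sub, coeff_C_mul]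
      rw [← leadingCoeff, ← hdeg, ← leadingCoeff, hc, div_mul_cancel₀ _ hl, sub_self]
    have h0' := RatFunc.algebraMap_ne_zero (K := ℂ) h0
    rw [← exp_logVal (div_ne_zero h0' hd'), ← exp_zero, exp_lt_exp, div_eq_mul_inv,
      logVal_mul _ h0' (inv_ne_zero hd'), logVal_inv, logVal_infty_algebraMap h0,
      logVal_infty_algebraMap hd]
    omega

/-! ### Frames and degrees -/

section Frames

variable {V V' : Type*} [AddCommGroup V] [Module FunField V] [AddCommGroup V']
  [Module FunField V'] {ι κ : Type*}

theorem subset_localSpan (p : P1) (e : ι → V) (i : ι) : e i ∈ localSpan p e :=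
  Submodule.subset_span ⟨i, rfl⟩

theorem smul_mem_of_mem_localRing {p : P1} {M : Submodule (localRing p) V} {a : FunField}
    (ha : a ∈ localRing p) {v : V} (hv : v ∈ M) : a • v ∈ M :=
  M.smul_mem (⟨a, ha⟩ : localRing p) hv

theorem mem_localSpan_iff [Fintype ι] {p : P1} (e : Module.Basis ι FunField V) {v : V} :
    v ∈ localSpan p e ↔ ∀ i, e.repr v i ∈ localRing p := by
  constructor
  · intro hv i
    obtain ⟨r, rfl⟩ := (Submodule.mem_span_range_iff_exists_fun (localRing p)).1 hv
    have : e.repr (∑ j, r j • e j) i = r i := by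
      have := e.repr_sum_self (fun j => (r j : FunField))
      exact congrFun this i
    rw [this]
    exact (r i).2
  · intro h
    rw [← e.sum_repr v]
    exact Submodule.sum_mem _ fun i _ => smul_mem_of_mem_localRing (h i) (subset_localSpan p e i)

variable [Fintype ι] [DecidableEq ι]

theorem basis_det_ne_zero (b e : Module.Basis ι FunField V) : b.det e ≠ 0 :=
  (b.isUnit_det e).ne_zero

theorem det_mem_localRing {p : P1} (e : Module.Basis ι FunField V) {f : ι → V}
    (hf : ∀ i, f i ∈ localSpan p e) : e.det f ∈ localRing p := by
  let M : Matrix ι ι (localRing p) := fun i j => ⟨e.repr (f j) i, (mem_localSpan_iff e).1 (hf j) i⟩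
  have hM : e.toMatrix f = (algebraMap (localRing p) FunField).mapMatrix M := by
    ext i j
    rfl
  rw [Module.Basis.det_apply, hM, ← RingHom.map_det]
  exact M.det.2

theorem logVal_det_mul (p : P1) (b e f : Module.Basis ι FunField V) :
    logVal p (b.det f) = logVal p (b.det e) + logVal p (e.det f) := by
  rw [← Module.Basis.det_mul_det b e f,
    logVal_mul p (basis_det_ne_zero b e) (basis_det_ne_zero e f)]

/-- The transition matrix from `e` to `f` is integral at `p`, so its determinant has nonnegative
order. The comparisons of degrees below rest on this local inequality. -/
theorem logVal_det_le {p : P1} (b e f : Module.Basis ι FunField V)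
    (h : ∀ i, f i ∈ localSpan p e) : logVal p (b.det f) ≤ logVal p (b.det e) := by
  have := (placeVal_le_one_iff (basis_det_ne_zero e f)).1 (det_mem_localRing e h)
  rw [logVal_det_mul p b e f]
  omega

theorem logVal_det_eq {p : P1} (b e f : Module.Basis ι FunField V)
    (h : localSpan p f = localSpan p e) : logVal p (b.det f) = logVal p (b.det e) :=
  le_antisymm (logVal_det_le b e f fun i => h ▸ subset_localSpan p f i)
    (logVal_det_le b f e fun i => h.symm ▸ subset_localSpan p e i)

namespace VectorBundle

theorem finite_stalk_ne (E : VectorBundle V) {κ : Type*} [Finite κ]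
    (b : Module.Basis κ FunField V) : {p | E.stalk p ≠ localSpan p b}.Finite := by
  obtain ⟨b₀, hb₀⟩ := E.exists_generic_frame
  refine (hb₀.union (finite_localSpan_ne b₀ b)).subset fun p hp => ?_
  by_contra hcon
  simp only [Set.mem_union, Set.mem_ofPred_eq, not_or, not_not] at hcon
  exact hp (hcon.1.trans hcon.2)

theorem finite_support_logVal_det (E : VectorBundle V) (b : Module.Basis ι FunField V)
    (e : P1 → Module.Basis ι FunField V) (he : ∀ p, E.stalk p = localSpan p (e p)) :
    (Function.support fun p => logVal p (b.det (e p))).Finite := by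
  refine (E.finite_stalk_ne b).subset fun p hp => ?_
  by_contra hcon
  simp only [Set.mem_ofPred_eq, not_not] at hcon
  refine hp ?_
  change logVal p (b.det (e p)) = 0
  rw [logVal_det_eq b b (e p) (by rw [← he, hcon]), Module.Basis.det_self, logVal_one]

/-- A new local frame changes the determinant by a unit at `p`. A new generic basis changes it by
one fixed rational function, whose orders sum to zero by the product formula. -/
theorem finsum_logVal_det_eq (E : VectorBundle V) (b b' : Module.Basis ι FunField V)
    (e e' : P1 → Module.Basis ι FunField V) (he : ∀ p, E.stalk p = localSpan p (e p))
    (he' : ∀ p, E.stalk p = localSpan p (e' p)) :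
    ∑ᶠ p, logVal p (b.det (e p)) = ∑ᶠ p, logVal p (b'.det (e' p)) := by
  have h : ∀ p, logVal p (b.det (e p)) = logVal p (b.det b') + logVal p (b'.det (e' p)) := by
    intro p
    rw [logVal_det_eq b (e' p) (e p) (by rw [← he, ← he']), logVal_det_mul p b b' (e' p)]
  rw [finsum_congr h, finsum_add_distrib (finite_support_logVal _)
    (E.finite_support_logVal_det b' e' he'), finsum_logVal (basis_det_ne_zero b b'), zero_add]

/-- Frees the degree from the chosen frames in its definition: any family of frames, over any finite
index type, may be used. -/
theorem degree_eq_finsum (E : VectorBundle V) (b : Module.Basis ι FunField V)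
    (e : P1 → Module.Basis ι FunField V) (he : ∀ p, E.stalk p = localSpan p (e p)) :
    E.degree = ∑ᶠ p, logVal p (b.det (e p)) := by
  let s : ι ≃ Fin (Module.finrank FunField V) :=
    Fintype.equivFinOfCardEq (Module.finrank_eq_card_basis b).symm
  have h1 := E.finsum_logVal_det_eq E.exists_generic_frame.choose (b.reindex s)
    (fun p => (E.exists_frame p).choose) (fun p => (e p).reindex s)
    (fun p => (E.exists_frame p).choose_spec)
    (fun p => by rw [he, ← localSpan_reindex p s (e p), ← Module.Basis.coe_reindex])
  refine h1.trans (finsum_congr fun p => ?_)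
  rw [Module.Basis.det_reindex]
  congr 2
  ext i
  simp

theorem finite (E : VectorBundle V) : Module.Finite FunField V :=
  Module.Finite.of_basis E.exists_generic_frame.choose

omit [DecidableEq ι] in
theorem exists_frames (E : VectorBundle V) (h : Fintype.card ι = Module.finrank FunField V) :
    ∃ e : P1 → Module.Basis ι FunField V, ∀ p, E.stalk p = localSpan p (e p) := by
  choose e he using E.exists_frame
  let s : Fin (Module.finrank FunField V) ≃ ι := (Fintype.equivFinOfCardEq h).symm
  refine ⟨fun p => (e p).reindex s, fun p => ?_⟩
  rw [he, ← localSpan_reindex p s (e p), ← Module.Basis.coe_reindex]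

/-- A linear isomorphism of generic fibres that maps stalks into stalks up to twists `c p`
bounds the degrees. -/
theorem degree_add_le (E : VectorBundle V) (E' : VectorBundle V') (T : V ≃ₗ[FunField] V')
    (c : P1 → FunField) (hc : ∀ p, c p ≠ 0)
    (hfin : (Function.support fun p => logVal p (c p)).Finite)
    (h : ∀ p, ∀ v ∈ E.stalk p, c p • T v ∈ E'.stalk p) :
    E.degree + Module.finrank FunField V * ∑ᶠ p, logVal p (c p) ≤ E'.degree := by
  classical
  have := E.finite
  let b := Module.finBasis FunField V
  obtain ⟨e, he⟩ := E.exists_frames (Fintype.card_fin _)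
  obtain ⟨e', he'⟩ := E'.exists_frames ((Fintype.card_fin _).trans T.finrank_eq)
  rw [E.degree_eq_finsum b e he, E'.degree_eq_finsum (b.map T) e' he']
  have hsup1 := E.finite_support_logVal_det b e he
  have hsup2 := E'.finite_support_logVal_det (b.map T) e' he'
  rw [mul_finsum' _ _ hfin, ← finsum_add_distrib hsup1]
  · refine finsum_le_finsum' ?_ hsup2 fun p => ?_
    · refine (hsup1.union hfin).subset fun p hp => ?_
      by_contra hcon
      simp only [Set.mem_union, Function.mem_support, not_or, not_not] at hcon
      refine hp ?_
      simp [hcon.1, hcon.2]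
    · have hu : IsUnit (c p) := (hc p).isUnit
      let f := (((e p).map T).isUnitSMul fun _ => hu)
      have hf : ∀ i, f i = c p • T (e p i) := fun i => by
        rw [Module.Basis.isUnitSMul_apply, Module.Basis.map_apply]
      have h1 := logVal_det_le (p := p) (b.map T) (e' p) f (fun i => by
        rw [hf, ← he']
        exact h p _ (he p ▸ subset_localSpan p (e p) i))
      -- Scaling every frame vector by `c p` contributes one factor per vector, hence the rank in
      -- the bound.
      have h2 : (b.map T).det f = c p ^ Module.finrank FunField V * b.det (e p) := by
        have h3 : (f : _ → V') = fun i => c p • T (e p i) := funext hf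
        have h4 := (b.map T).det.map_smul_univ (fun _ => c p) (fun i => T (e p i))
        rw [h3, h4, Module.Basis.det_map, Finset.prod_const, Finset.card_univ, Fintype.card_fin,
          smul_eq_mul]
        congr 2
        ext i
        simp
      rw [h2, logVal_mul _ (pow_ne_zero _ (hc p)) (basis_det_ne_zero _ _), logVal_pow] at h1
      change logVal p _ + _ * logVal p _ ≤ logVal p _
      linarith
  · refine hfin.subset fun p hp hcon => hp ?_
    simp only at hcon
    simp [hcon]

theorem degree_le_of_linearEquiv (E : VectorBundle V) (E' : VectorBundle V')
    (T : V ≃ₗ[FunField] V') (h : ∀ p, ∀ v ∈ E.stalk p, T v ∈ E'.stalk p) :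
    E.degree ≤ E'.degree := by
  have := E.degree_add_le E' T (fun _ => 1) (fun _ => one_ne_zero) (by simp [logVal_one])
    (by simpa using h)
  simpa [logVal_one] using this

theorem Iso.degree_eq {E : VectorBundle V} {E' : VectorBundle V'} (i : E.Iso E') :
    E.degree = E'.degree :=
  le_antisymm (E.degree_le_of_linearEquiv E' i.toEquiv fun p v hv => (i.map_stalk p v).2 hv)
    (E'.degree_le_of_linearEquiv E i.toEquiv.symm fun p v hv => by
      rwa [← i.map_stalk p, i.toEquiv.apply_symm_apply])

theorem degree_eq_zero_of_subsingleton [Subsingleton V] (E : VectorBundle V) : E.degree = 0 := by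
  obtain ⟨e, he⟩ := E.exists_frames (ι := Empty)
    (by simp [Module.finrank_zero_of_subsingleton])
  rw [E.degree_eq_finsum (Module.Basis.empty V) e he]
  simp [logVal_one]

theorem degree_sub_bot (E : VectorBundle V) : (E.sub ⊥).degree = 0 :=
  degree_eq_zero_of_subsingleton _

theorem degree_sub_top (E : VectorBundle V) : (E.sub ⊤).degree = E.degree :=
  Iso.degree_eq ⟨Submodule.topEquiv, fun _ _ => Iff.rfl⟩

end VectorBundle

end Frames

/-- The generator of the stalk of `𝒪(n)` at `p`. -/
def twist (n : ℤ) : P1 → FunField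
  | ∞ => RatFunc.X ^ n
  | OnePoint.some _ => 1

@[simp] theorem twist_infty (n : ℤ) : twist n ∞ = RatFunc.X ^ n := rfl

@[simp] theorem twist_coe (n : ℤ) (a : ℂ) : twist n (a : P1) = 1 := rfl

theorem twist_ne_zero (n : ℤ) (p : P1) : twist n p ≠ 0 := by
  induction p using OnePoint.rec with
  | infty => exact zpow_ne_zero _ RatFunc.X_ne_zero
  | coe a => exact one_ne_zero

theorem placeVal_twist (n : ℤ) (p : P1) : placeVal p (twist n p) = poleBound n p := by
  induction p using OnePoint.rec with
  | infty =>
    classical exact RatFunc.inftyValuation.X_zpow ℂ n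
  | coe a => exact map_one _

theorem logVal_twist_infty (n : ℤ) : logVal ∞ (twist n ∞) = n := by
  rw [logVal, placeVal_twist]
  exact log_exp n

theorem logVal_twist_of_ne (n : ℤ) {p : P1} (hp : p ≠ ∞) : logVal p (twist n p) = 0 := by
  induction p using OnePoint.rec with
  | infty => exact (hp rfl).elim
  | coe a => exact logVal_one _

theorem finsum_logVal_twist (n : ℤ) : ∑ᶠ p, logVal p (twist n p) = n := by
  rw [finsum_eq_single _ ∞ fun p hp => logVal_twist_of_ne n hp, logVal_twist_infty]

theorem mem_lineStalk_iff {n : ℤ} {p : P1} {f : FunField} :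
    f ∈ (lineBundle n).stalk p ↔ f / twist n p ∈ localRing p := by
  rw [mem_localRing_iff, map_div₀, div_le_one₀ (zero_lt_iff.2 (placeVal_ne_zero (twist_ne_zero n p))),
    placeVal_twist]
  rfl

theorem degree_lineBundle (n : ℤ) : (lineBundle n).degree = n := by
  have he : ∀ p, (lineBundle n).stalk p = localSpan p (unitBasis (twist n p) (twist_ne_zero n p)) :=
    fun p => by
      rw [coe_unitBasis]
      exact lineStalk_eq_localSpan n p _ (twist_ne_zero n p) (placeVal_twist n p)
  rw [(lineBundle n).degree_eq_finsum (unitBasis 1 one_ne_zero) _ he]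
  have hdet : ∀ p, (unitBasis 1 one_ne_zero).det (unitBasis (twist n p) (twist_ne_zero n p)) =
      twist n p := fun p => by
    rw [Module.Basis.det_apply, Matrix.det_unique, Module.Basis.toMatrix_apply, coe_unitBasis]
    have : twist n p = twist n p • unitBasis 1 one_ne_zero () := by simp [coe_unitBasis]
    conv_lhs => rw [this]
    change (unitBasis 1 one_ne_zero).repr (twist n p • unitBasis 1 one_ne_zero ()) () = twist n p
    rw [LinearEquiv.map_smul, Finsupp.smul_apply, Module.Basis.repr_self, Finsupp.single_eq_same,
      smul_eq_mul, mul_one]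
  simp_rw [hdet]
  exact finsum_logVal_twist n

/-! ### Quotient bundles and additivity of the degree -/

section Quotients

variable {V Q : Type*} [AddCommGroup V] [Module FunField V] [AddCommGroup Q]
  [Module FunField Q]

/-- The local ring is a principal ideal domain, so a finitely generated torsion-free module over it
is free, and a basis over it stays independent over its fraction field. -/
theorem exists_basis_of_fg {p : P1} {M : Submodule (localRing p) V} (hM : M.FG)
    (hspan : ⊤ ≤ Submodule.span FunField (M : Set V)) :
    ∃ e : Module.Basis (Fin (Module.finrank FunField V)) FunField V, M = localSpan p e := by
  have : Module.Finite (localRing p) M := Module.Finite.iff_fg.2 hM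
  have : Module.Free (localRing p) M := Module.free_of_finite_type_torsion_free'
  let c := Module.Free.chooseBasis (localRing p) M
  let w : Module.Free.ChooseBasisIndex (localRing p) M → V := fun i => (c i : V)
  have hw : localSpan p w = M := by
    have h1 := congrArg (Submodule.map M.subtype) c.span_eq
    rw [Submodule.map_span, Submodule.map_top, Submodule.range_subtype, ← Set.range_comp] at h1
    exact h1
  have hli : LinearIndependent (localRing p) w :=
    c.linearIndependent.map' M.subtype (Submodule.ker_subtype _)
  rw [LinearIndependent.iff_fractionRing (localRing p) FunField] at hli
  have htop : ⊤ ≤ Submodule.span FunField (Set.range w) := by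
    refine hspan.trans (Submodule.span_le.2 fun x hx => ?_)
    rw [← hw] at hx
    exact Submodule.span_le_restrictScalars (localRing p) FunField _ hx
  obtain ⟨e, he⟩ := exists_fin_basis (Module.Basis.mk hli htop)
  exact ⟨e, by rw [he, Module.Basis.coe_mk, hw]⟩

theorem map_mem_localSpan {ι : Type*} (π : V →ₗ[FunField] Q) {p : P1} {e : ι → V} {v : V}
    (hv : v ∈ localSpan p e) : π v ∈ localSpan p (π ∘ e) := by
  induction hv using Submodule.span_induction with
  | mem x hx =>
    obtain ⟨i, rfl⟩ := hx
    exact subset_localSpan p (π ∘ e) i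
  | zero => rw [map_zero]; exact zero_mem _
  | add x y _ _ hx hy => rw [map_add]; exact add_mem hx hy
  | smul a x _ hx =>
    change π ((a : FunField) • x) ∈ _
    rw [map_smul]
    exact Submodule.smul_mem _ a hx

namespace VectorBundle

/-- The image of the stalk at `p` under a linear map. -/
def mapStalk (E : VectorBundle V) (π : V →ₗ[FunField] Q) (p : P1) :
    Submodule (localRing p) Q where
  carrier := π '' E.stalk p
  add_mem' := by
    rintro _ _ ⟨v, hv, rfl⟩ ⟨w, hw, rfl⟩
    exact ⟨v + w, (E.stalk p).add_mem hv hw, map_add _ _ _⟩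
  zero_mem' := ⟨0, (E.stalk p).zero_mem, map_zero _⟩
  smul_mem' := by
    rintro c _ ⟨v, hv, rfl⟩
    exact ⟨c • v, (E.stalk p).smul_mem c hv, π.map_smul (c : FunField) v⟩

theorem mapStalk_eq_localSpan (E : VectorBundle V) (π : V →ₗ[FunField] Q) {p : P1} {ι : Type*}
    {e : ι → V} (he : E.stalk p = localSpan p e) : E.mapStalk π p = localSpan p (π ∘ e) := by
  refine le_antisymm ?_ (Submodule.span_le.2 ?_)
  · rintro _ ⟨v, hv, rfl⟩
    rw [he] at hv
    exact map_mem_localSpan π hv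
  · rintro _ ⟨i, rfl⟩
    exact ⟨e i, he ▸ subset_localSpan p e i, rfl⟩

/-- The quotient bundle of `E` with generic fibre `Q`. -/
def quot (E : VectorBundle V) (π : V →ₗ[FunField] Q) (hπ : Function.Surjective π) :
    VectorBundle Q where
  stalk := E.mapStalk π
  exists_frame p := by
    obtain ⟨e, he⟩ := E.exists_frame p
    rw [E.mapStalk_eq_localSpan π he]
    refine exists_basis_of_fg (Submodule.fg_span (Set.finite_range _)) ?_
    have h1 : Submodule.span FunField (Set.range (π ∘ e)) = ⊤ := by
      rw [Set.range_comp, ← Submodule.map_span, e.span_eq, Submodule.map_top,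
        LinearMap.range_eq_top.2 hπ]
    rw [← h1]
    exact Submodule.span_mono Submodule.subset_span
  exists_generic_frame := by
    obtain ⟨b, hb⟩ := E.exists_generic_frame
    have := E.finite
    have : Module.Finite FunField Q := Module.Finite.of_surjective π hπ
    let c := Module.finBasis FunField Q
    choose v hv using fun i => hπ (c i)
    -- Away from finitely many points `b` is a frame of `E`, the images `π ∘ b` are integral
    -- combinations of `c`, and the lifts `v` of `c` are integral combinations of `b`. There `c` is
    -- a frame of the quotient.
    refine ⟨c, (hb.union ((finite_not_localSpan_le (π ∘ b) c).union
      (finite_not_localSpan_le v b))).subset fun p hp => ?_⟩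
    by_contra hcon
    simp only [Set.mem_union, Set.mem_ofPred_eq, not_or, not_not] at hcon
    obtain ⟨h1, h2, h3⟩ := hcon
    refine hp ?_
    rw [E.mapStalk_eq_localSpan π h1]
    refine le_antisymm h2 (Submodule.span_le.2 ?_)
    rintro _ ⟨i, rfl⟩
    rw [← hv i]
    exact map_mem_localSpan π (h3 (subset_localSpan p v i))

end VectorBundle

variable {ι κ : Type*} (π : V →ₗ[FunField] Q)

/-- The isomorphism `ker π × Q ≃ V` given by a section `s` of `π`. -/
def kerProdEquiv (s : Q →ₗ[FunField] V) (hs : ∀ q, π (s q) = q) :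
    (LinearMap.ker π × Q) ≃ₗ[FunField] V where
  toFun x := x.1 + s x.2
  map_add' x y := by
    simp only [Prod.fst_add, Prod.snd_add, Submodule.coe_add, map_add]; abel
  map_smul' a x := by simp
  invFun v := (⟨v - s (π v), by simp [hs]⟩, π v)
  left_inv x := by
    have h : π ((x.1 : V) + s x.2) = x.2 := by rw [map_add, hs, LinearMap.map_coe_ker, zero_add]
    refine Prod.ext (Subtype.ext ?_) h
    change (x.1 : V) + s x.2 - s (π (x.1 + s x.2)) = x.1
    rw [h, add_sub_cancel_right]
  right_inv v := sub_add_cancel _ _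

/-- The basis of `V` made of a basis of `ker π` and lifts `g` of a basis of `Q`. -/
def adaptedBasis (bU : Module.Basis ι FunField (LinearMap.ker π)) (c : Module.Basis κ FunField Q)
    (g : κ → V) (hg : ∀ j, π (g j) = c j) : Module.Basis (ι ⊕ κ) FunField V :=
  (bU.prod c).map (kerProdEquiv π (c.constr ℕ g) fun q => by
    have : π ∘ₗ c.constr ℕ g = LinearMap.id := c.ext fun j => by simp [hg]
    exact LinearMap.congr_fun this q)

variable {π} (bU : Module.Basis ι FunField (LinearMap.ker π)) (c : Module.Basis κ FunField Q)
    {g : κ → V} (hg : ∀ j, π (g j) = c j)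

@[simp] theorem adaptedBasis_inl (i : ι) : adaptedBasis π bU c g hg (Sum.inl i) = bU i := by
  simp [adaptedBasis, kerProdEquiv]

@[simp] theorem adaptedBasis_inr (j : κ) : adaptedBasis π bU c g hg (Sum.inr j) = g j := by
  simp [adaptedBasis, kerProdEquiv]

theorem adaptedBasis_repr_inr (v : V) (j : κ) :
    (adaptedBasis π bU c g hg).repr v (Sum.inr j) = c.repr (π v) j := rfl

theorem adaptedBasis_repr_inl (u : LinearMap.ker π) (i : ι) :
    (adaptedBasis π bU c g hg).repr u (Sum.inl i) = bU.repr u i := by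
  have : (kerProdEquiv π (c.constr ℕ g) fun q => by
    have : π ∘ₗ c.constr ℕ g = LinearMap.id := c.ext fun j => by simp [hg]
    exact LinearMap.congr_fun this q).symm (u : V) = (u, 0) := by
    rw [LinearEquiv.symm_apply_eq]
    simp [kerProdEquiv]
  exact (congrArg (fun x => (bU.prod c).repr x (Sum.inl i)) this).trans rfl

/-- The transition matrix between adapted bases is block triangular. The choice of lifts enters only
the off-diagonal block. -/
theorem adaptedBasis_det [Fintype ι] [DecidableEq ι] [Fintype κ] [DecidableEq κ]
    (bU' : Module.Basis ι FunField (LinearMap.ker π)) (c' : Module.Basis κ FunField Q)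
    {g' : κ → V} (hg' : ∀ j, π (g' j) = c' j) :
    (adaptedBasis π bU c g hg).det (adaptedBasis π bU' c' g' hg') = bU.det bU' * c.det c' := by
  have h : (adaptedBasis π bU c g hg).toMatrix (adaptedBasis π bU' c' g' hg') =
      Matrix.fromBlocks (bU.toMatrix bU')
        (.of fun i j => (adaptedBasis π bU c g hg).repr (g' j) (Sum.inl i)) 0 (c.toMatrix c') := by
    ext (i | i) (j | j)
    · simp only [Module.Basis.toMatrix_apply, adaptedBasis_inl, adaptedBasis_repr_inl,
        Matrix.fromBlocks_apply₁₁]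
    · simp only [Module.Basis.toMatrix_apply, adaptedBasis_inr, Matrix.fromBlocks_apply₁₂,
        Matrix.of_apply]
    · simp only [Module.Basis.toMatrix_apply, adaptedBasis_inl, adaptedBasis_repr_inr,
        Matrix.fromBlocks_apply₂₁, LinearMap.map_coe_ker, map_zero, Finsupp.coe_zero,
        Pi.zero_apply, Matrix.zero_apply]
    · simp only [Module.Basis.toMatrix_apply, adaptedBasis_inr, adaptedBasis_repr_inr,
        Matrix.fromBlocks_apply₂₂, hg']
  rw [Module.Basis.det_apply, h, Matrix.det_fromBlocks_zero₂₁, ← Module.Basis.det_apply,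
    ← Module.Basis.det_apply]

/-- Exactness on stalks: subtracting from a germ a lift of its image leaves a germ of the kernel
subbundle. -/
theorem VectorBundle.stalk_eq_localSpan_adaptedBasis [Fintype ι] [Fintype κ] (E : VectorBundle V)
    {p : P1} (hU : E.subStalk (LinearMap.ker π) p = localSpan p bU)
    (hc : E.mapStalk π p = localSpan p c) (hgE : ∀ j, g j ∈ E.stalk p) :
    E.stalk p = localSpan p (adaptedBasis π bU c g hg) := by
  have hUE : ∀ i, (bU i : V) ∈ E.stalk p := fun i => by
    have : bU i ∈ E.subStalk (LinearMap.ker π) p := hU ▸ subset_localSpan p bU i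
    exact this
  refine le_antisymm (fun v hv => ?_) (Submodule.span_le.2 ?_)
  · have hr : ∀ j, c.repr (π v) j ∈ localRing p := by
      rw [← mem_localSpan_iff c, ← hc]
      exact ⟨v, hv, rfl⟩
    have hw : ∑ j, c.repr (π v) j • g j ∈ E.stalk p :=
      Submodule.sum_mem _ fun j _ => smul_mem_of_mem_localRing (hr j) (hgE j)
    have hk : π (v - ∑ j, c.repr (π v) j • g j) = 0 := by
      simp only [map_sub, map_sum, map_smul, hg, c.sum_repr, sub_self]
    let u : LinearMap.ker π := ⟨v - ∑ j, c.repr (π v) j • g j, hk⟩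
    have hu : u ∈ localSpan p bU := hU ▸ (E.stalk p).sub_mem hv hw
    have hv' : v = (LinearMap.ker π).subtype u + ∑ j, c.repr (π v) j • g j :=
      (sub_add_cancel _ _).symm
    rw [hv']
    refine Submodule.add_mem _ ?_ (Submodule.sum_mem _ fun j _ => ?_)
    · refine Submodule.span_mono ?_ (map_mem_localSpan (LinearMap.ker π).subtype hu)
      rintro _ ⟨i, rfl⟩
      exact ⟨Sum.inl i, adaptedBasis_inl bU c hg i⟩
    · refine smul_mem_of_mem_localRing (hr j) ?_
      exact Submodule.subset_span ⟨Sum.inr j, adaptedBasis_inr bU c hg j⟩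
  · rintro _ ⟨i | j, rfl⟩
    · rw [adaptedBasis_inl]; exact hUE i
    · rw [adaptedBasis_inr]; exact hgE j

/-- The degree is additive in short exact sequences. -/
theorem VectorBundle.degree_eq_sub_add_quot (E : VectorBundle V) (hπ : Function.Surjective π) :
    E.degree = (E.sub (LinearMap.ker π)).degree + (E.quot π hπ).degree := by
  have := E.finite
  have : Module.Finite FunField Q := Module.Finite.of_surjective π hπ
  let bU := Module.finBasis FunField (LinearMap.ker π)
  let c := Module.finBasis FunField Q
  choose g hg using fun j => hπ (c j)
  obtain ⟨eU, heU⟩ := (E.sub (LinearMap.ker π)).exists_frames (Fintype.card_fin _)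
  obtain ⟨eQ, heQ⟩ := (E.quot π hπ).exists_frames (Fintype.card_fin _)
  have hlift : ∀ p j, ∃ v ∈ E.stalk p, π v = eQ p j := fun p j => by
    have h : eQ p j ∈ (E.quot π hπ).stalk p := heQ p ▸ subset_localSpan p (eQ p) j
    exact h
  choose g' hgE' hg' using hlift
  rw [E.degree_eq_finsum (adaptedBasis π bU c g hg)
      (fun p => adaptedBasis π (eU p) (eQ p) (g' p) (hg' p))
      (fun p => E.stalk_eq_localSpan_adaptedBasis (eU p) (eQ p) (hg' p) (heU p) (heQ p) (hgE' p)),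
    (E.sub (LinearMap.ker π)).degree_eq_finsum bU eU heU, (E.quot π hπ).degree_eq_finsum c eQ heQ,
    ← finsum_add_distrib ((E.sub _).finite_support_logVal_det bU eU heU)
      ((E.quot π hπ).finite_support_logVal_det c eQ heQ)]
  refine finsum_congr fun p => ?_
  rw [adaptedBasis_det, logVal_mul _ (basis_det_ne_zero _ _) (basis_det_ne_zero _ _)]

theorem VectorBundle.degree_sub_sub (E : VectorBundle V) (W : Submodule FunField V)
    (S : Submodule FunField W) :
    ((E.sub W).sub S).degree = (E.sub (S.map W.subtype)).degree :=
  Iso.degree_eq ⟨W.equivSubtypeMap S, fun _ _ => Iff.rfl⟩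

end Quotients

/-! ### Kernels and images of twisted homomorphisms. -/

section Step

variable {V₁ V₂ : Type*} [AddCommGroup V₁] [Module FunField V₁] [AddCommGroup V₂]
  [Module FunField V₂]

/-- The kernel and the image of a twisted homomorphism from the subbundle `W` of `E₁` to the
quotient of `E₂` by `U`: their ranks and the inequality between their degrees. -/
theorem VectorBundle.exists_ker_image (E₁ : VectorBundle V₁) (E₂ : VectorBundle V₂)
    (f : V₁ →+ V₂) (c : P1 → FunField) (hc : ∀ p, c p ≠ 0)
    (hfin : (Function.support fun p => logVal p (c p)).Finite)
    (h : ∀ p, ∀ v ∈ E₁.stalk p, c p • f v ∈ E₂.stalk p)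
    (W : Submodule FunField V₁) (U : Submodule FunField V₂)
    (hlin : ∀ a : FunField, ∀ v ∈ W, f (a • v) - a • f v ∈ U) :
    ∃ (N : Submodule FunField V₁) (M : Submodule FunField V₂), N ≤ W ∧ U ≤ M ∧
      (∀ v ∈ W, v ∈ N ↔ f v ∈ U) ∧ (∀ v ∈ W, f v ∈ M) ∧
      (∀ X, U ≤ X → (∀ v ∈ W, f v ∈ X) → M ≤ X) ∧
      Module.finrank FunField W + Module.finrank FunField U =
        Module.finrank FunField M + Module.finrank FunField N ∧
      (E₁.sub W).degree - (E₁.sub N).degree +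
          ((Module.finrank FunField W : ℤ) - Module.finrank FunField N) * ∑ᶠ p, logVal p (c p) ≤
        (E₂.sub M).degree - (E₂.sub U).degree := by
  have := E₁.finite
  have := E₂.finite
  -- Although `f` is only additive, `hlin` makes it linear on `W` modulo `U`.
  let g : W →ₗ[FunField] V₂ ⧸ U :=
    { toFun := fun w => U.mkQ (f w)
      map_add' := fun x y => by simp
      map_smul' := fun a x => by
        rw [RingHom.id_apply, ← map_smul, ← sub_eq_zero, ← map_sub]
        exact (Submodule.Quotient.mk_eq_zero U).2 (hlin a x x.2) }
  have hg : ∀ w, g w = U.mkQ (f w) := fun _ => rfl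
  let M : Submodule FunField V₂ := (LinearMap.range g).comap U.mkQ
  let π₁ := g.rangeRestrict
  have hπ₁ : Function.Surjective π₁ := g.surjective_rangeRestrict
  let π₂ : M →ₗ[FunField] LinearMap.range g :=
    (U.mkQ.domRestrict M).codRestrict _ fun m => m.2
  have hπ₂ : Function.Surjective π₂ := by
    rintro ⟨_, w, rfl⟩
    exact ⟨⟨f w, w, rfl⟩, rfl⟩
  have hUM : U ≤ M := fun u hu => ⟨0, by
    rw [map_zero]; exact ((Submodule.Quotient.mk_eq_zero U).2 hu).symm⟩
  have hk₂ : (LinearMap.ker π₂).map M.subtype = U := by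
    ext u
    constructor
    · rintro ⟨m, hm, rfl⟩
      exact (Submodule.Quotient.mk_eq_zero U).1 (congrArg Subtype.val hm)
    · intro hu
      exact ⟨⟨u, hUM hu⟩, Subtype.ext ((Submodule.Quotient.mk_eq_zero U).2 hu), rfl⟩
  have hd₁ := (E₁.sub W).degree_eq_sub_add_quot hπ₁
  have hd₂ := (E₂.sub M).degree_eq_sub_add_quot hπ₂
  rw [VectorBundle.degree_sub_sub] at hd₁ hd₂
  rw [hk₂] at hd₂
  have hr₁ := LinearMap.finrank_range_add_finrank_ker π₁
  have hr₂ := LinearMap.finrank_range_add_finrank_ker π₂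
  rw [LinearMap.range_eq_top.2 hπ₁, finrank_top,
    ← Submodule.finrank_map_subtype_eq W] at hr₁
  rw [LinearMap.range_eq_top.2 hπ₂, finrank_top,
    ← Submodule.finrank_map_subtype_eq M, hk₂] at hr₂
  -- The space `range g` carries two bundle structures, as a quotient of `W` and as a quotient of
  -- `M`. After the twist by `c` the identity maps the first into the second, which compares their
  -- degrees.
  have hle := ((E₁.sub W).quot π₁ hπ₁).degree_add_le ((E₂.sub M).quot π₂ hπ₂)
    (LinearEquiv.refl FunField _) c hc hfin (by
      rintro p _ ⟨w, hw, rfl⟩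
      refine ⟨⟨c p • f w, M.smul_mem _ ⟨w, rfl⟩⟩, h p w hw, Subtype.ext ?_⟩
      exact map_smul U.mkQ (c p) (f w))
  refine ⟨(LinearMap.ker π₁).map W.subtype, M, Submodule.map_subtype_le _ _, hUM, ?_,
    fun v hv => ⟨⟨v, hv⟩, rfl⟩, ?_, by omega, ?_⟩
  · intro v hv
    rw [← Submodule.Quotient.mk_eq_zero U]
    constructor
    · rintro ⟨w, hw, rfl⟩
      exact congrArg Subtype.val hw
    · intro hv0
      exact ⟨⟨v, hv⟩, Subtype.ext hv0, rfl⟩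
  · rintro X hUX hX v ⟨w, hw⟩
    have : f w - v ∈ U := (Submodule.Quotient.eq U).1 hw
    have h2 := X.sub_mem (hX w w.2) (hUX this)
    rwa [sub_sub_cancel] at h2
  · rw [← hr₁]
    push_cast
    rw [add_sub_cancel_right]
    linarith

/-- The degree of subbundles is supermodular. -/
theorem VectorBundle.degree_add_degree_le (E : VectorBundle V₁) (W U : Submodule FunField V₁) :
    (E.sub W).degree + (E.sub U).degree ≤ (E.sub (W ⊓ U)).degree + (E.sub (W ⊔ U)).degree := by
  -- For the identity without twist, the map is `W → E / U`, with kernel `W ⊓ U` and image `(W ⊔ U)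
  -- / U`.
  obtain ⟨N, M, hN, hU, hNU, hM, hX, -, h⟩ := E.exists_ker_image E (AddMonoidHom.id V₁)
    (fun _ => 1) (fun _ => one_ne_zero) (by simp [logVal_one]) (by simp) W U (by simp)
  have h1 : N = W ⊓ U := by
    ext v
    exact ⟨fun hv => ⟨hN hv, (hNU v (hN hv)).1 hv⟩, fun hv => (hNU v hv.1).2 hv.2⟩
  have h2 : M = W ⊔ U :=
    le_antisymm (hX _ le_sup_right fun v hv => Submodule.mem_sup_left hv) (sup_le hM hU)
  subst h1 h2
  simp only [logVal_one, finsum_zero, mul_zero, add_zero] at h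
  linarith

end Step

/-! ### Splitting of vector bundles -/

/-- A uniformizer at `p`. -/
def unif : P1 → FunField
  | ∞ => RatFunc.X⁻¹
  | OnePoint.some a => RatFunc.X - RatFunc.C a

@[simp] theorem unif_infty : unif ∞ = RatFunc.X⁻¹ := rfl

@[simp] theorem unif_coe (a : ℂ) : unif (a : P1) = RatFunc.X - RatFunc.C a := rfl

theorem unif_ne_zero (p : P1) : unif p ≠ 0 := by
  induction p using OnePoint.rec with
  | infty => exact inv_ne_zero RatFunc.X_ne_zero
  | coe a => exact X_sub_C_ne_zero' a

theorem logVal_unif (p : P1) : logVal p (unif p) = -1 := by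
  induction p using OnePoint.rec with
  | infty => rw [unif_infty, logVal_inv, logVal_infty_X]
  | coe a => exact logVal_coe_X_sub_C a

theorem unif_mem (p : P1) : unif p ∈ localRing p := by
  rw [mem_localRing_iff, placeVal_le_one_iff (unif_ne_zero p), logVal_unif]
  norm_num

theorem exists_eq_unif_mul {p : P1} {f : FunField} (hf : placeVal p f < 1) :
    ∃ g ∈ localRing p, f = unif p * g := by
  rcases eq_or_ne f 0 with rfl | h0
  · exact ⟨0, zero_mem _, by simp⟩
  refine ⟨(unif p)⁻¹ * f, ?_, by rw [mul_inv_cancel_left₀ (unif_ne_zero p)]⟩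
  have hu := inv_ne_zero (unif_ne_zero p)
  rw [← exp_logVal h0, ← exp_zero, exp_lt_exp] at hf
  rw [mem_localRing_iff, placeVal_le_one_iff (mul_ne_zero hu h0), logVal_mul _ hu h0, logVal_inv,
    logVal_unif]
  omega

theorem exists_unif_pow_mul_mem (p : P1) (f : FunField) :
    ∃ N : ℕ, ∀ n, N ≤ n → unif p ^ n * f ∈ localRing p := by
  rcases eq_or_ne f 0 with rfl | h0
  · exact ⟨0, fun n _ => by rw [mul_zero]; exact zero_mem _⟩
  refine ⟨(logVal p f).toNat, fun n hn => ?_⟩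
  have hu := pow_ne_zero n (unif_ne_zero p)
  rw [mem_localRing_iff, placeVal_le_one_iff (mul_ne_zero hu h0), logVal_mul _ hu h0, logVal_pow,
    logVal_unif]
  omega

theorem C_mem (p : P1) (c : ℂ) : RatFunc.C c ∈ localRing p := by
  rw [← RatFunc.algebraMap_eq_C]
  exact constant_mem p c

theorem X_mem (a : ℂ) : (RatFunc.X : FunField) ∈ localRing (a : P1) := by
  rw [mem_localRing_iff, ← RatFunc.algebraMap_X]
  exact placeVal_coe_algebraMap_le_one a X

theorem X_sub_C_mem (a b : ℂ) : RatFunc.X - RatFunc.C b ∈ localRing (a : P1) :=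
  sub_mem (X_mem a) (C_mem _ b)

section Splitting

variable {V : Type*} [AddCommGroup V] [Module FunField V] {ι : Type*} [Fintype ι]

theorem exists_unif_pow_smul_mem {p : P1} (e : Module.Basis ι FunField V) (v : V) :
    ∃ N : ℕ, unif p ^ N • v ∈ localSpan p e := by
  classical
  choose N hN using fun i => exists_unif_pow_mul_mem p (e.repr v i)
  refine ⟨Finset.univ.sup N, (mem_localSpan_iff e).2 fun i => ?_⟩
  rw [map_smul, Finsupp.smul_apply, smul_eq_mul]
  exact hN i _ (Finset.le_sup (Finset.mem_univ i))

/-- Take a germ of `M` outside the span of `f` and multiply it by the uniformizer until one more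
factor would bring it into the span. The coordinates of that next multiple reduce to constants,
because the residue field is `ℂ`. If all these constants vanished, one factor could be divided out
and the germ would already be in the span. -/
theorem exists_lift_relation {p : P1} {M : Submodule (localRing p) V}
    (f : Module.Basis ι FunField V) (hf : ∀ i, f i ∈ M) (hne : M ≠ localSpan p f) :
    ∃ c : ι → ℂ, c ≠ 0 ∧ (unif p)⁻¹ • ∑ i, RatFunc.C (c i) • f i ∈ M := by
  classical
  have hle : localSpan p f ≤ M := Submodule.span_le.2 (by rintro _ ⟨i, rfl⟩; exact hf i)
  obtain ⟨v, hv, hvf⟩ := Set.not_subset.1 fun h => hne (le_antisymm h hle)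
  have hex := exists_unif_pow_smul_mem (p := p) f v
  set n := Nat.find hex with hn
  have hspec : unif p ^ n • v ∈ localSpan p f := Nat.find_spec hex
  have hn0 : n ≠ 0 := fun h0 => hvf (by
    rw [h0, pow_zero, one_smul] at hspec
    exact hspec)
  obtain ⟨k, hk⟩ := Nat.exists_eq_succ_of_ne_zero hn0
  set w := unif p ^ k • v with hw
  have hwM : w ∈ M := smul_mem_of_mem_localRing (pow_mem (unif_mem p) k) hv
  have hwf : w ∉ localSpan p f := Nat.find_min hex (by omega)
  have huw : unif p • w ∈ localSpan p f := by
    rw [hw, smul_smul, ← pow_succ', ← Nat.succ_eq_add_one, ← hk]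
    exact hspec
  choose c hc using fun i => exists_constant_sub_lt_one ((mem_localSpan_iff f).1 huw i)
  choose s hs hse using fun i => exists_eq_unif_mul (hc i)
  have hsum : (unif p)⁻¹ • ∑ i, RatFunc.C (c i) • f i = w - ∑ i, s i • f i := by
    have h1 : ∑ i, RatFunc.C (c i) • f i = unif p • w - unif p • ∑ i, s i • f i := by
      rw [← f.sum_repr (unif p • w), Finset.smul_sum, ← Finset.sum_sub_distrib]
      refine Finset.sum_congr rfl fun i _ => ?_
      rw [smul_smul (unif p) (s i), ← hse, ← sub_smul, sub_sub_cancel, RatFunc.algebraMap_eq_C]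
    rw [h1, ← smul_sub, inv_smul_smul₀ (unif_ne_zero p)]
  have hsf : ∑ i, s i • f i ∈ localSpan p f :=
    Submodule.sum_mem _ fun i _ => smul_mem_of_mem_localRing (hs i) (subset_localSpan p f i)
  refine ⟨c, ?_, by rw [hsum]; exact M.sub_mem hwM (hle hsf)⟩
  rintro rfl
  refine hwf ?_
  have : w = ∑ i, s i • f i := by
    rw [← sub_eq_zero, ← hsum]; simp
  rw [this]
  exact hsf

namespace VectorBundle

/-- The basis `b` defines an injective homomorphism `⨁ 𝒪(m i) → E`. -/
def HasSections (E : VectorBundle V) (b : ι → V) (m : ι → ℤ) : Prop :=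
  ∀ p i, twist (m i) p • b i ∈ E.stalk p

omit [Fintype ι] in
theorem isUnit_twist (m : ι → ℤ) (p : P1) (i : ι) : IsUnit (twist (m i) p) :=
  (twist_ne_zero _ _).isUnit

/-- The frame at `p` of the subsheaf `⨁ 𝒪(m i)` given by a basis of the generic fibre. -/
def twistedBasis (b : Module.Basis ι FunField V) (m : ι → ℤ) (p : P1) :
    Module.Basis ι FunField V :=
  b.isUnitSMul (isUnit_twist m p)

omit [Fintype ι] in
theorem twistedBasis_apply (b : Module.Basis ι FunField V) (m : ι → ℤ) (p : P1) (i : ι) :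
    twistedBasis b m p i = twist (m i) p • b i :=
  Module.Basis.isUnitSMul_apply _ _

theorem logVal_det_twistedBasis [DecidableEq ι] (b : Module.Basis ι FunField V) (m : ι → ℤ)
    (p : P1) : logVal p (b.det (twistedBasis b m p)) = logVal p (twist (∑ i, m i) p) := by
  have h1 : (twistedBasis b m p : ι → V) = fun i => twist (m i) p • b i :=
    funext fun i => twistedBasis_apply b m p i
  have h2 := b.det.map_smul_univ (fun i => twist (m i) p) b
  rw [h1, h2, Module.Basis.det_self, smul_eq_mul, mul_one]
  congr 1
  induction p using OnePoint.rec with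
  | infty =>
    simp only [twist_infty]
    induction (Finset.univ : Finset ι) using Finset.induction with
    | empty => simp
    | insert i s hi ih =>
      rw [Finset.prod_insert hi, Finset.sum_insert hi, ih, zpow_add₀ RatFunc.X_ne_zero]
  | coe a => simp

theorem finsum_logVal_det_twistedBasis [DecidableEq ι] (b : Module.Basis ι FunField V)
    (m : ι → ℤ) : ∑ᶠ p, logVal p (b.det (twistedBasis b m p)) = ∑ i, m i := by
  simp_rw [logVal_det_twistedBasis]
  exact finsum_logVal_twist _

/-- At each point the frame of `⨁ 𝒪(m i)` lies in the stalk of `E`, so the determinants compare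
locally. This bound is what allows a choice of `m` with maximal sum. -/
theorem HasSections.sum_le_degree {E : VectorBundle V} {b : Module.Basis ι FunField V}
    {m : ι → ℤ} (h : E.HasSections b m) : ∑ i, m i ≤ E.degree := by
  classical
  obtain ⟨e, he⟩ := E.exists_frames (Module.finrank_eq_card_basis b).symm
  rw [E.degree_eq_finsum b e he, ← finsum_logVal_det_twistedBasis b m]
  refine finsum_le_finsum' ?_ (E.finite_support_logVal_det b e he) fun p => ?_
  · refine (Set.finite_singleton (∞ : P1)).subset fun p hp => ?_
    by_contra hcon
    refine hp ?_
    change logVal p _ = 0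
    rw [logVal_det_twistedBasis]
    exact logVal_twist_of_ne _ hcon
  · refine logVal_det_le b (e p) (twistedBasis b m p) fun i => ?_
    rw [twistedBasis_apply, ← he]
    exact h p i

/-- Only finitely many finite points obstruct regularity, and powers of `X - a` remove them. A pole
may remain at `∞`, to be absorbed by a negative twist. -/
theorem exists_polynomial_smul_mem (E : VectorBundle V) (v : V) :
    ∃ h : FunField, h ≠ 0 ∧ ∀ a : ℂ, h • v ∈ E.stalk (a : P1) := by
  classical
  obtain ⟨b, hb⟩ := E.exists_generic_frame
  have hfin : {a : ℂ | v ∉ E.stalk (a : P1)}.Finite := by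
    refine Set.Finite.subset ((hb.union (finite_not_localSpan_le (fun _ : Unit => v) b)).preimage
      OnePoint.coe_injective.injOn) fun a ha => ?_
    by_contra hcon
    simp only [Set.preimage_union, Set.mem_union, Set.mem_preimage, Set.mem_ofPred_eq, not_or,
      not_not] at hcon
    exact ha (hcon.1 ▸ hcon.2 (Submodule.subset_span ⟨(), rfl⟩))
  have hN : ∀ a : ℂ, ∃ N : ℕ, (RatFunc.X - RatFunc.C a) ^ N • v ∈ E.stalk (a : P1) := fun a => by
    obtain ⟨e, he⟩ := E.exists_frame (a : P1)
    rw [he]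
    exact exists_unif_pow_smul_mem e v
  choose N hN using hN
  refine ⟨∏ a ∈ hfin.toFinset, (RatFunc.X - RatFunc.C a) ^ N a,
    Finset.prod_ne_zero_iff.2 fun a _ => pow_ne_zero _ (X_sub_C_ne_zero' a), fun a => ?_⟩
  have hmem : ∀ s : Finset ℂ,
      ∏ a ∈ s, (RatFunc.X - RatFunc.C a) ^ N a ∈ localRing (a : P1) := fun s =>
    prod_mem fun b _ => pow_mem (X_sub_C_mem a b) _
  by_cases ha : v ∈ E.stalk (a : P1)
  · exact smul_mem_of_mem_localRing (hmem _) ha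
  · rw [← Finset.prod_erase_mul _ _ (hfin.mem_toFinset.2 ha), mul_smul]
    exact smul_mem_of_mem_localRing (hmem _) (hN a)

omit [Fintype ι] in
theorem exists_hasSections (E : VectorBundle V) (b : Module.Basis ι FunField V) :
    ∃ (b' : Module.Basis ι FunField V) (m : ι → ℤ), E.HasSections b' m := by
  choose h h0 hmem using fun i => E.exists_polynomial_smul_mem (b i)
  let b' := b.isUnitSMul fun i => (h0 i).isUnit
  have hb' : ∀ i, b' i = h i • b i := fun i => Module.Basis.isUnitSMul_apply _ _
  have hN : ∀ i, ∃ N : ℕ, unif ∞ ^ N • b' i ∈ E.stalk ∞ := fun i => by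
    obtain ⟨e, he⟩ := E.exists_frame ∞
    rw [he]
    exact exists_unif_pow_smul_mem e _
  choose N hN using hN
  refine ⟨b', fun i => -(N i), fun p i => ?_⟩
  induction p using OnePoint.rec with
  | infty =>
    have := hN i
    rwa [unif_infty, inv_pow, ← zpow_natCast, ← zpow_neg] at this
  | coe a =>
    rw [twist_coe, one_smul, hb']
    exact hmem i a

/-- Exchanging `b i` for `v` multiplies the determinant by the `i`-th coordinate of `v`, so the
family is still a basis. -/
theorem HasSections.update {E : VectorBundle V} {b : Module.Basis ι FunField V} {m : ι → ℤ}
    (h : E.HasSections b m) {i : ι} {n : ℤ} {v : V} (hv : b.repr v i ≠ 0)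
    (hmem : ∀ p, twist n p • v ∈ E.stalk p) :
    ∃ (b' : Module.Basis ι FunField V) (m' : ι → ℤ), E.HasSections b' m' ∧
      ∑ j, m' j = ∑ j, m j - m i + n := by
  classical
  have hdet : b.det (Function.update b i v) = b.repr v i := by
    conv_lhs => rw [← b.sum_repr v]
    rw [AlternatingMap.map_update_sum, Finset.sum_eq_single i]
    · rw [AlternatingMap.map_update_smul, Function.update_eq_self, Module.Basis.det_self,
        smul_eq_mul, mul_one]
    · intro j _ hj
      rw [AlternatingMap.map_update_smul, AlternatingMap.map_update_self _ _ hj.symm, smul_zero]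
    · intro hi
      exact (hi (Finset.mem_univ i)).elim
  have hu : IsUnit (b.det (Function.update b i v)) := by
    rw [hdet]; exact hv.isUnit
  obtain ⟨hli, hsp⟩ := b.is_basis_iff_det.2 hu
  refine ⟨Module.Basis.mk hli hsp.ge, Function.update m i n, fun p j => ?_, ?_⟩
  · rw [Module.Basis.mk_apply]
    by_cases hj : j = i
    · subst hj
      rw [Function.update_self, Function.update_self]
      exact hmem p
    · rw [Function.update_of_ne hj, Function.update_of_ne hj]
      exact h p j
  · rw [Finset.sum_update_of_mem (Finset.mem_univ i), ← Finset.add_sum_erase _ m (Finset.mem_univ i),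
      Finset.sdiff_singleton_eq_erase]
    ring

/-- A missing germ at `p` gives a constant relation among the generators that is divisible by the
uniformizer. The divided combination replaces one generator and gains one twist. -/
theorem HasSections.exists_larger {E : VectorBundle V} {b : Module.Basis ι FunField V}
    {m : ι → ℤ} (h : E.HasSections b m) {p : P1}
    (hp : E.stalk p ≠ localSpan p (twistedBasis b m p)) :
    ∃ (b' : Module.Basis ι FunField V) (m' : ι → ℤ), E.HasSections b' m' ∧
      ∑ j, m' j = ∑ j, m j + 1 := by
  classical
  obtain ⟨c, hc0, hc⟩ := exists_lift_relation (twistedBasis b m p)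
    (fun i => by rw [twistedBasis_apply]; exact h p i) hp
  obtain ⟨i₁, hi₁⟩ := Function.ne_iff.1 hc0
  -- The generator to be replaced is one of least twist among those in the relation, so the others
  -- have twist to spare for a section of `E(-m i - 1)`.
  obtain ⟨i, hi, hmin⟩ := (Finset.univ.filter fun i => c i ≠ 0).exists_min_image m
    ⟨i₁, by simpa using hi₁⟩
  simp only [Finset.mem_filter, Finset.mem_univ, true_and] at hi hmin
  have hCi : (RatFunc.C (c i) : FunField) ≠ 0 := by simpa using hi
  simp_rw [twistedBasis_apply] at hc
  suffices H : ∃ v, b.repr v i ≠ 0 ∧ ∀ q, twist (m i + 1) q • v ∈ E.stalk q by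
    obtain ⟨v, hv, hq⟩ := H
    obtain ⟨b', m', h1, h2⟩ := h.update hv hq
    exact ⟨b', m', h1, by rw [h2]; ring⟩
  have hb : ∀ (q : ℂ) (j : ι), b j ∈ E.stalk (q : P1) := fun q j => by
    simpa using h q j
  have hX : (RatFunc.X : FunField) ≠ 0 := RatFunc.X_ne_zero
  induction p using OnePoint.rec with
  | coe a =>
    simp only [twist_coe, one_smul, unif_coe] at hc
    -- Dividing by `X - a` introduces no pole at other finite points and gains a zero at `∞`, which
    -- pays for the extra twist.
    refine ⟨(RatFunc.X - RatFunc.C a)⁻¹ • ∑ j, RatFunc.C (c j) • b j, ?_, fun q => ?_⟩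
    · rw [map_smul, Finsupp.smul_apply, b.repr_sum_self, smul_eq_mul]
      exact mul_ne_zero (inv_ne_zero (X_sub_C_ne_zero' a)) hCi
    · induction q using OnePoint.rec with
      | coe q =>
        rw [twist_coe, one_smul]
        by_cases hq : q = a
        · rw [hq]; exact hc
        · refine smul_mem_of_mem_localRing ?_ (Submodule.sum_mem _ fun j _ =>
            smul_mem_of_mem_localRing (C_mem _ _) (hb q j))
          rw [mem_localRing_iff, placeVal_le_one_iff (inv_ne_zero (X_sub_C_ne_zero' a)),
            logVal_inv, logVal_coe_X_sub_C_of_ne hq, neg_zero]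
      | infty =>
        have hu : (RatFunc.X : FunField) * (RatFunc.X - RatFunc.C a)⁻¹ ∈ localRing ∞ := by
          rw [mem_localRing_iff, placeVal_le_one_iff
            (mul_ne_zero hX (inv_ne_zero (X_sub_C_ne_zero' a))), logVal_mul _ hX
            (inv_ne_zero (X_sub_C_ne_zero' a)), logVal_inv, logVal_infty_X_sub_C, logVal_infty_X]
          norm_num
        rw [twist_infty, zpow_add_one₀ hX, smul_smul, mul_assoc, mul_comm, mul_smul,
          Finset.smul_sum]
        refine smul_mem_of_mem_localRing hu (Submodule.sum_mem _ fun j _ => ?_)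
        rw [smul_comm]
        by_cases hj : c j = 0
        · rw [hj, map_zero, zero_smul]; exact zero_mem _
        · refine smul_mem_of_mem_localRing (C_mem _ _) ?_
          have h1 : (RatFunc.X : FunField) ^ m i • b j =
              unif ∞ ^ (m j - m i).toNat • twist (m j) ∞ • b j := by
            rw [smul_smul, unif_infty, twist_infty, inv_pow, ← zpow_natCast, ← zpow_neg,
              ← zpow_add₀ hX, Int.toNat_of_nonneg (sub_nonneg.2 (hmin j hj))]
            congr 2
            ring
          rw [h1]
          exact smul_mem_of_mem_localRing (pow_mem (unif_mem ∞) _) (h ∞ j)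
  | infty =>
    simp only [twist_infty, unif_infty, inv_inv] at hc
    -- The powers of `X` align the twists to that of `b i`. Minimality of `m i` makes the relevant
    -- exponents nonnegative, so no finite poles arise.
    refine ⟨∑ j, (RatFunc.C (c j) * RatFunc.X ^ (m j - m i)) • b j, ?_, fun q => ?_⟩
    · rw [b.repr_sum_self, sub_self, zpow_zero, mul_one]
      exact hCi
    · induction q using OnePoint.rec with
      | coe q =>
        rw [twist_coe, one_smul]
        refine Submodule.sum_mem _ fun j _ => ?_
        by_cases hj : c j = 0
        · rw [hj, map_zero, zero_mul, zero_smul]; exact zero_mem _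
        · refine smul_mem_of_mem_localRing (mul_mem (C_mem _ _) ?_) (hb q j)
          rw [← Int.toNat_of_nonneg (sub_nonneg.2 (hmin j hj)), zpow_natCast]
          exact pow_mem (X_mem q) _
      | infty =>
        convert hc using 1
        rw [twist_infty, Finset.smul_sum, Finset.smul_sum]
        refine Finset.sum_congr rfl fun j _ => ?_
        rw [smul_smul, smul_smul, smul_smul]
        congr 1
        rw [zpow_add_one₀ hX, zpow_sub₀ hX]
        field_simp

/-- Every vector bundle on the projective line splits into line bundles. -/
theorem exists_splitting (E : VectorBundle V) (b₀ : Module.Basis ι FunField V) :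
    ∃ (b : Module.Basis ι FunField V) (m : ι → ℤ), E.HasSections b m ∧
      (∀ p, E.stalk p = localSpan p (twistedBasis b m p)) ∧ E.degree = ∑ i, m i := by
  classical
  obtain ⟨b₁, m₁, h₁⟩ := E.exists_hasSections b₀
  -- A subsheaf `⨁ 𝒪(m i)` with maximal sum must be all of `E`, for otherwise `exists_larger` would
  -- increase the sum.
  obtain ⟨n, ⟨b, m, h, rfl⟩, hmax⟩ := Int.exists_greatest_of_bdd
    (P := fun n => ∃ (b : Module.Basis ι FunField V) (m : ι → ℤ), E.HasSections b m ∧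
      ∑ i, m i = n)
    ⟨E.degree, by rintro _ ⟨b, m, h, rfl⟩; exact h.sum_le_degree⟩ ⟨_, b₁, m₁, h₁, rfl⟩
  have hst : ∀ p, E.stalk p = localSpan p (twistedBasis b m p) := by
    intro p
    by_contra hp
    obtain ⟨b', m', h', hs⟩ := h.exists_larger hp
    have := hmax _ ⟨b', m', h', hs⟩
    omega
  exact ⟨b, m, h, hst, by
    rw [E.degree_eq_finsum b _ hst, finsum_logVal_det_twistedBasis]⟩

omit [Fintype ι] in
-- The partial sum `⨁ 𝒪(m (s k))` is a subsheaf of full rank in its saturation. With one or two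
-- indices this turns bounds on lines and planes into bounds on the twists.
theorem HasSections.sum_le_degree_sub {E : VectorBundle V} {b : Module.Basis ι FunField V}
    {m : ι → ℤ} (h : E.HasSections b m) {κ : Type*} [Fintype κ] {s : κ → ι}
    (hs : Function.Injective s) :
    Module.finrank FunField (Submodule.span FunField (Set.range (b ∘ s))) = Fintype.card κ ∧
      ∑ k, m (s k) ≤ (E.sub (Submodule.span FunField (Set.range (b ∘ s)))).degree := by
  have hli : LinearIndependent FunField (b ∘ s) := b.linearIndependent.comp s hs
  refine ⟨finrank_span_eq_card hli, ?_⟩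
  refine HasSections.sum_le_degree (b := Module.Basis.span hli) (m := m ∘ s) fun p k => ?_
  change ((twist (m (s k)) p • Module.Basis.span hli k : _) : V) ∈ E.stalk p
  rw [Submodule.coe_smul, Module.Basis.span_apply]
  exact h p (s k)

/-- A vector bundle has a line subbundle whose degree is at least its slope. -/
theorem exists_line (E : VectorBundle V) {W : Submodule FunField V} (hW : W ≠ ⊥) :
    ∃ L ≤ W, Module.finrank FunField L = 1 ∧
      (E.sub W).degree ≤ Module.finrank FunField W * (E.sub L).degree := by
  have := E.finite
  have : Nontrivial W := (Submodule.nontrivial_iff_ne_bot).2 hW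
  obtain ⟨b, m, h, -, hd⟩ := (E.sub W).exists_splitting (Module.finBasis FunField W)
  have : Nonempty (Fin (Module.finrank FunField W)) :=
    Fin.pos_iff_nonempty.1 Module.finrank_pos
  obtain ⟨i, -, hi⟩ := Finset.univ.exists_max_image m Finset.univ_nonempty
  obtain ⟨hr, hle⟩ := h.sum_le_degree_sub (s := fun _ : Unit => i) (fun _ _ _ => rfl)
  refine ⟨(Submodule.span FunField (Set.range (b ∘ fun _ : Unit => i))).map W.subtype,
    Submodule.map_subtype_le _ _, ?_, ?_⟩
  · rw [Submodule.finrank_map_subtype_eq, hr]; rfl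
  · rw [← degree_sub_sub, hd]
    calc ∑ j, m j ≤ ∑ _j : Fin (Module.finrank FunField W), m i :=
          Finset.sum_le_sum fun j hj => hi j hj
      _ = Module.finrank FunField W * m i := by simp
      _ ≤ _ := by
        refine mul_le_mul_of_nonneg_left ?_ (Int.natCast_nonneg _)
        simpa using hle

end VectorBundle

end Splitting

/-! ### Bundles of degree `-2` and rank `3` -/

section RankThree

variable {V : Type*} [AddCommGroup V] [Module FunField V]

namespace VectorBundle

/-- Line subbundles have degree at most `0`, and plane subbundles have degree at most `-1`. -/
structure SubDegreeBounds (E : VectorBundle V) : Prop where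
  line : ∀ W : Submodule FunField V, Module.finrank FunField W = 1 → (E.sub W).degree ≤ 0
  plane : ∀ W : Submodule FunField V, Module.finrank FunField W = 2 → (E.sub W).degree ≤ -1

theorem mem_localSpan_twistedBasis_iff {ι : Type*} [Fintype ι] {p : P1}
    (b : Module.Basis ι FunField V) (m : ι → ℤ) {v : V} :
    v ∈ localSpan p (twistedBasis b m p) ↔
      ∀ i, b.repr v i ∈ (lineBundle (m i)).stalk p := by
  rw [mem_localSpan_iff]
  refine forall_congr' fun i => ?_
  rw [mem_lineStalk_iff, div_eq_inv_mul, twistedBasis, Module.Basis.repr_isUnitSMul]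
  congr! 1
  rw [Units.smul_def, smul_eq_mul, Units.val_inv_eq_inv_val, IsUnit.unit_spec]

/-- A splitting with three summands as an isomorphism. -/
def isoOfSplitting (E : VectorBundle V) (b : Module.Basis (Fin 3) FunField V) (m : Fin 3 → ℤ)
    (h : ∀ p, E.stalk p = localSpan p (twistedBasis b m p)) :
    E.Iso ((lineBundle (m 0)).prod ((lineBundle (m 1)).prod (lineBundle (m 2)))) where
  toEquiv := b.equivFun.trans
    { toFun := fun x => (x 0, x 1, x 2)
      map_add' := fun _ _ => rfl
      map_smul' := fun _ _ => rfl
      invFun := fun y => ![y.1, y.2.1, y.2.2]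
      left_inv := fun x => by
        ext i
        fin_cases i <;> rfl
      right_inv := fun _ => rfl }
  map_stalk p v := by
    rw [h, mem_localSpan_twistedBasis_iff, Fin.forall_fin_succ, Fin.forall_fin_succ,
      Fin.forall_fin_one]
    rfl

/-- Since each pair sums to at most -1, the remaining twist is at least -1. So all twists are -1 or
0, exactly one is 0, and the transposition brings it to the front. -/
theorem exists_eq_zero_of_bounds {m : Fin 3 → ℤ} (h1 : ∀ i, m i ≤ 0)
    (h2 : ∀ i j, i ≠ j → m i + m j ≤ -1) (hs : ∑ i, m i = -2) :
    ∃ i, m (Equiv.swap 0 i 0) = 0 ∧ m (Equiv.swap 0 i 1) = -1 ∧ m (Equiv.swap 0 i 2) = -1 := by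
  rw [Fin.sum_univ_three] at hs
  have h01 := h2 0 1 (by decide)
  have h02 := h2 0 2 (by decide)
  have h12 := h2 1 2 (by decide)
  have := h1 0
  have := h1 1
  have := h1 2
  by_cases a0 : m 0 = 0
  · refine ⟨0, ?_, ?_, ?_⟩ <;> simp <;> omega
  by_cases a1 : m 1 = 0
  · refine ⟨1, ?_, ?_, ?_⟩
    · simpa using a1
    · simp; omega
    · rw [Equiv.swap_apply_of_ne_of_ne (by decide) (by decide)]; omega
  · refine ⟨2, ?_, ?_, ?_⟩
    · simp; omega
    · rw [Equiv.swap_apply_of_ne_of_ne (by decide) (by decide)]; omega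
    · simp; omega

theorem nonempty_iso_of_bounds (E : VectorBundle V) (hr : Module.finrank FunField V = 3)
    (hd : E.degree = -2) (hE : E.SubDegreeBounds) :
    Nonempty (E.Iso ((lineBundle 0).prod ((lineBundle (-1)).prod (lineBundle (-1))))) := by
  have := E.finite
  obtain ⟨b, m, h, hst, hdeg⟩ := E.exists_splitting (Module.finBasisOfFinrankEq FunField V hr)
  obtain ⟨i, h0, h1, h2⟩ := exists_eq_zero_of_bounds (m := m)
    (fun i => by
      obtain ⟨hr, hle⟩ := h.sum_le_degree_sub (s := fun _ : Unit => i) (fun _ _ _ => rfl)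
      have := hE.line _ hr
      simp only [Finset.univ_unique, Finset.sum_singleton] at hle
      exact hle.trans this)
    (fun i j hij => by
      obtain ⟨hr, hle⟩ := h.sum_le_degree_sub (s := ![i, j]) (by
        intro x y hxy
        fin_cases x <;> fin_cases y <;> simp_all)
      have := hE.plane _ hr
      simp only [Fin.sum_univ_two, Matrix.cons_val_zero, Matrix.cons_val_one] at hle
      exact hle.trans this)
    (hdeg ▸ hd)
  have hst' : ∀ p, E.stalk p = localSpan p
      (twistedBasis (b.reindex (Equiv.swap 0 i)) (m ∘ Equiv.swap 0 i) p) := fun p => by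
    have : (twistedBasis (b.reindex (Equiv.swap 0 i)) (m ∘ Equiv.swap 0 i) p : Fin 3 → V) =
        twistedBasis b m p ∘ (Equiv.swap 0 i).symm := by
      ext j
      simp [twistedBasis_apply]
    rw [this, localSpan_reindex, hst]
  have := E.isoOfSplitting _ _ hst'
  simp only [Function.comp_apply, h0, h1, h2] at this
  exact ⟨this⟩

theorem exists_sub_iso_of_iso_prod {V' V'' : Type*} [AddCommGroup V'] [Module FunField V']
    [AddCommGroup V''] [Module FunField V''] {E : VectorBundle V} {E' : VectorBundle V'}
    {E'' : VectorBundle V''} (i : E.Iso (E'.prod E'')) :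
    ∃ W, Nonempty ((E.sub W).Iso E') := by
  let f : V' →ₗ[FunField] V := i.toEquiv.symm.toLinearMap ∘ₗ LinearMap.inl FunField V' V''
  have hf : Function.Injective f := i.toEquiv.symm.injective.comp LinearMap.inl_injective
  refine ⟨LinearMap.range f, ⟨(LinearEquiv.ofInjective f hf).symm, ?_⟩⟩
  rintro p ⟨_, x, rfl⟩
  have h1 : (LinearEquiv.ofInjective f hf).symm ⟨f x, x, rfl⟩ = x := by
    rw [LinearEquiv.symm_apply_eq]; rfl
  rw [h1]
  change _ ↔ f x ∈ E.stalk p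
  rw [← i.map_stalk p, show i.toEquiv (f x) = (x, 0) from i.toEquiv.apply_symm_apply _]
  exact ⟨fun h => ⟨h, zero_mem _⟩, fun h => h.1⟩

/-- Distinct lines of degree 0 meet in zero, so by supermodularity they would span a plane of degree
at least 0. -/
theorem SubDegreeBounds.eq_of_iso {E : VectorBundle V} (hE : E.SubDegreeBounds)
    {W W' : Submodule FunField V} (i : (E.sub W).Iso (lineBundle 0))
    (i' : (E.sub W').Iso (lineBundle 0)) : W = W' := by
  have := E.finite
  by_contra hne
  have hr : Module.finrank FunField W = 1 := by
    rw [i.toEquiv.finrank_eq, Module.finrank_self]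
  have hr' : Module.finrank FunField W' = 1 := by
    rw [i'.toEquiv.finrank_eq, Module.finrank_self]
  have hd := i.degree_eq
  have hd' := i'.degree_eq
  rw [degree_lineBundle] at hd hd'
  have hinf : W ⊓ W' = ⊥ := by
    rw [← Submodule.finrank_eq_zero (R := FunField)]
    by_contra h0
    have h1 := Submodule.finrank_mono (inf_le_left : W ⊓ W' ≤ W)
    have h2 : W ⊓ W' = W := Submodule.eq_of_le_of_finrank_eq inf_le_left (by omega)
    have h3 : W ⊓ W' = W' := Submodule.eq_of_le_of_finrank_eq inf_le_right (by omega)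
    exact hne (h2.symm.trans h3)
  have hsup := Submodule.finrank_sup_add_finrank_inf_eq W W'
  have hle := E.degree_add_degree_le W W'
  rw [hinf, finrank_bot] at hsup
  have := hE.plane (W ⊔ W') (by omega)
  rw [hinf, degree_sub_bot] at hle
  omega

theorem existsUnique_sub_iso (E : VectorBundle V) (hE : E.SubDegreeBounds)
    (h : Nonempty (E.Iso ((lineBundle 0).prod ((lineBundle (-1)).prod (lineBundle (-1)))))) :
    ∃! W : Submodule FunField V, Nonempty ((E.sub W).Iso (lineBundle 0)) := by
  obtain ⟨W, hW⟩ := exists_sub_iso_of_iso_prod h.some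
  exact ⟨W, hW, fun W' hW' => hE.eq_of_iso hW'.some hW.some⟩

end VectorBundle

end RankThree

/-! ### Dimensions of fibres and jumps -/

section Fibres

variable {V : Type*} [AddCommGroup V] [Module FunField V]

theorem mem_maximalIdeal_of_placeVal_lt_one {p : P1} {x : localRing p}
    (hx : placeVal p (x : FunField) < 1) : x ∈ IsLocalRing.maximalIdeal (localRing p) := by
  rw [IsLocalRing.mem_maximalIdeal, mem_nonunits_iff]
  intro hu
  obtain ⟨y, hy⟩ := hu.exists_right_inv
  have h1 : placeVal p (x : FunField) * placeVal p (y : FunField) = 1 := by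
    rw [← map_mul]
    exact (congrArg (fun z : localRing p => placeVal p (z : FunField)) hy).trans (map_one _)
  have h2 : placeVal p (x : FunField) * placeVal p (y : FunField) < 1 :=
    (mul_le_of_le_one_right' (show placeVal p (y : FunField) ≤ 1 from y.2)).trans_lt hx
  exact h2.ne h1

namespace VectorBundle

/-- Modulo the maximal ideal the coefficients of a germ may be replaced by constants, because the
residue field is `ℂ`. -/
theorem span_range_toFibre (E : VectorBundle V) {p : P1} {ι : Type*} [Fintype ι]
    (e : ι → E.stalk p) (he : E.stalk p = localSpan p fun i => (e i : V)) :
    Submodule.span ℂ (Set.range fun i => E.toFibre p (e i)) = ⊤ := by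
  rw [eq_top_iff]
  rintro x -
  obtain ⟨v, rfl⟩ := Submodule.mkQ_surjective _ x
  have hv : (v : V) ∈ localSpan p fun i => (e i : V) := he ▸ v.2
  obtain ⟨r, hr⟩ := (Submodule.mem_span_range_iff_exists_fun (localRing p)).1 hv
  have hv' : v = ∑ i, r i • e i := Subtype.ext (by rw [← hr]; simp)
  choose c hc using fun i => exists_constant_sub_lt_one (r i).2
  have h1 : E.toFibre p v = ∑ i, c i • E.toFibre p (e i) := by
    rw [hv', map_sum]
    refine Finset.sum_congr rfl fun i _ => ?_
    change E.toFibre p _ = constants p (c i) • E.toFibre p (e i)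
    have h2 : r i • e i - constants p (c i) • e i = (r i - constants p (c i)) • e i :=
      (sub_smul _ _ _).symm
    rw [← map_smul, ← sub_eq_zero, ← map_sub, h2]
    refine (Submodule.Quotient.mk_eq_zero _).2 (Submodule.smul_mem_smul ?_ Submodule.mem_top)
    exact mem_maximalIdeal_of_placeVal_lt_one (hc i)
  change E.toFibre p v ∈ _
  rw [h1]
  exact Submodule.sum_mem _ fun i _ => Submodule.smul_mem _ _ (Submodule.subset_span ⟨i, rfl⟩)

theorem exists_span_fibre_eq_top (E : VectorBundle V) (p : P1) :
    ∃ x : Fin (Module.finrank FunField V) → E.Fibre p, Submodule.span ℂ (Set.range x) = ⊤ := by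
  obtain ⟨e, he⟩ := E.exists_frame p
  exact ⟨_, E.span_range_toFibre (fun i => ⟨e i, he ▸ subset_localSpan p e i⟩) he⟩

instance (E : VectorBundle V) (p : P1) : Module.Finite ℂ (E.Fibre p) := by
  obtain ⟨x, hx⟩ := E.exists_span_fibre_eq_top p
  exact ⟨hx ▸ Submodule.fg_span (Set.finite_range x)⟩

theorem finrank_fibre_le (E : VectorBundle V) (p : P1) :
    Module.finrank ℂ (E.Fibre p) ≤ Module.finrank FunField V := by
  obtain ⟨x, hx⟩ := E.exists_span_fibre_eq_top p
  have h := finrank_range_le_card (R := ℂ) x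
  rwa [Set.finrank, hx, finrank_top, Fintype.card_fin] at h

/-- A crude bound, sufficient because the weights are small. -/
theorem Flag.jump_le {E : VectorBundle V} {p : P1} {r : ℕ} (L : Flag E p r)
    (W : Submodule FunField V) (j : Fin r) : L.jump W j ≤ Module.finrank FunField V :=
  (Submodule.finrank_quotient_le _).trans ((Submodule.finrank_le _).trans (E.finrank_fibre_le p))

end VectorBundle

end Fibres

/-! ### The twist by logarithmic forms and the stability inequality -/

theorem logVal_regCoeff (p : P1) : logVal p (regCoeff p) = logVal p (twist 2 p) := by
  induction p using OnePoint.rec with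
  | infty =>
    change logVal ∞ (-RatFunc.X ^ 2) = _
    rw [logVal_neg, logVal_pow, logVal_infty_X, logVal_twist_infty]
    norm_num
  | coe a => rfl

theorem logVal_logCoeff (p : P1) : logVal p (logCoeff p) = logVal p (twist 2 p) - 1 := by
  induction p using OnePoint.rec with
  | infty =>
    change logVal ∞ (-RatFunc.X) = _
    rw [logVal_neg, logVal_infty_X, logVal_twist_infty]
    norm_num
  | coe a =>
    rw [logVal_twist_of_ne _ (OnePoint.coe_ne_infty a)]
    exact logVal_coe_X_sub_C a

theorem regCoeff_ne_zero (p : P1) : regCoeff p ≠ 0 := by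
  induction p using OnePoint.rec with
  | infty => exact neg_ne_zero.2 (pow_ne_zero 2 RatFunc.X_ne_zero)
  | coe a => exact one_ne_zero

theorem logCoeff_ne_zero (p : P1) : logCoeff p ≠ 0 := by
  induction p using OnePoint.rec with
  | infty => exact neg_ne_zero.2 RatFunc.X_ne_zero
  | coe a => exact X_sub_C_ne_zero' a

open scoped Classical in
/-- The local factor of the twist by `Ω¹(t₁ + ⋯ + tₙ)`. -/
def logTwist {n : ℕ} (t : Fin n → P1) (p : P1) : FunField :=
  if p ∈ Set.range t then logCoeff p else regCoeff p

section LogTwist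

variable {n : ℕ} (t : Fin n → P1)

theorem logTwist_ne_zero (p : P1) : logTwist t p ≠ 0 := by
  unfold logTwist
  split_ifs
  exacts [logCoeff_ne_zero p, regCoeff_ne_zero p]

open scoped Classical in
theorem logVal_logTwist (p : P1) :
    logVal p (logTwist t p) = logVal p (twist 2 p) + if p ∈ Set.range t then -1 else 0 := by
  unfold logTwist
  split_ifs
  · exact logVal_logCoeff p
  · rw [logVal_regCoeff, add_zero]

theorem finite_support_logVal_twist (m : ℤ) :
    (Function.support fun p => logVal p (twist m p)).Finite :=
  (Set.finite_singleton ∞).subset fun p hp => by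
    by_contra hcon
    exact hp (logVal_twist_of_ne m hcon)

open scoped Classical in
theorem finite_support_range_indicator :
    (Function.support fun p => if p ∈ Set.range t then (-1 : ℤ) else 0).Finite :=
  (Set.finite_range t).subset fun p hp => by
    by_contra hcon
    exact hp (if_neg hcon)

theorem finite_support_logVal_logTwist :
    (Function.support fun p => logVal p (logTwist t p)).Finite := by
  classical
  simp_rw [logVal_logTwist]
  exact ((finite_support_logVal_twist 2).union (finite_support_range_indicator t)).subset
    (Function.support_add _ _)

/-- This is minus the degree of `Ω¹(t₁ + ⋯ + tₙ)`: the canonical divisor contributes 2, and each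
pole, counted once as the points are distinct, contributes -1. -/
theorem finsum_logVal_logTwist (ht : Function.Injective t) :
    ∑ᶠ p, logVal p (logTwist t p) = 2 - n := by
  classical
  simp_rw [logVal_logTwist]
  rw [finsum_add_distrib (finite_support_logVal_twist 2) (finite_support_range_indicator t),
    finsum_logVal_twist, finsum_eq_sum_of_support_subset (s := Finset.univ.image t)]
  · rw [Finset.sum_image fun _ _ _ _ h => ht h]
    simp [sub_eq_add_neg]
  · intro p hp
    by_contra hcon
    exact hp (if_neg (by simpa using hcon))

end LogTwist

section Stability

variable {V₁ V₂ : Type*} [AddCommGroup V₁] [Module FunField V₁] [AddCommGroup V₂]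
  [Module FunField V₂]

theorem LogConnection.logTwist_smul_mem {n : ℕ} {t : Fin n → P1} {E₁ : VectorBundle V₁}
    {E₂ : VectorBundle V₂} {φ : VectorBundle.Hom E₁ E₂} (D : LogConnection t φ) (p : P1) (v : V₁)
    (hv : v ∈ E₁.stalk p) : logTwist t p • D.toFun v ∈ E₂.stalk p := by
  unfold logTwist
  split_ifs with h
  · obtain ⟨i, rfl⟩ := h
    exact D.log_pole i v hv
  · exact D.regular p h v hv

theorem sum_weight_jump_le {t : Fin 3 → P1} {V : Type*} [AddCommGroup V] [Module FunField V]
    {E : VectorBundle V} (hE : Module.finrank FunField V = 3) (l : ∀ i, E.Flag (t i) 3)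
    (W : Submodule FunField V) {α : Fin 3 → Fin 3 → ℚ} (hα : IsParabolicWeight α)
    (hα' : ∀ i j, α i j < 1 / 1000) : ∑ i, ∑ j, α i j * (l i).jump W j ≤ 27 / 1000 := by
  have h : ∀ i j, α i j * (l i).jump W j ≤ 3 / 1000 := fun i j => by
    have h1 : ((l i).jump W j : ℚ) ≤ 3 := by
      exact_mod_cast hE ▸ (l i).jump_le W j
    have h2 := hα.pos i j
    have h3 := hα' i j
    nlinarith
  calc ∑ i, ∑ j, α i j * (l i).jump W j ≤ ∑ _i : Fin 3, ∑ _j : Fin 3, (3 / 1000 : ℚ) :=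
        Finset.sum_le_sum fun i _ => Finset.sum_le_sum fun j _ => h i j
    _ = 27 / 1000 := by norm_num

theorem sum_weight_jump_nonneg {t : Fin 3 → P1} {V : Type*} [AddCommGroup V] [Module FunField V]
    {E : VectorBundle V} (l : ∀ i, E.Flag (t i) 3)
    (W : Submodule FunField V) {α : Fin 3 → Fin 3 → ℚ} (hα : IsParabolicWeight α) :
    0 ≤ ∑ i, ∑ j, α i j * (l i).jump W j :=
  Finset.sum_nonneg fun i _ => Finset.sum_nonneg fun j _ =>
    mul_nonneg (hα.pos i j).le (Nat.cast_nonneg _)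

/-- Clearing denominators in the slope inequality leaves an integer on one side and the weights on
the other. The weights contribute less than 1, so they disappear. -/
theorem ParabolicPhiConnection.IsStable.degree_bound {t : Fin 3 → P1} {ν : Fin 3 → Fin 3 → ℂ}
    {P : ParabolicPhiConnection V₁ V₂ (-2) t ν} {α : Fin 3 → Fin 3 → ℚ} {γ : ℕ}
    (hP : P.IsStable α γ) (hα : IsParabolicWeight α) (hα' : ∀ i j, α i j < 1 / 1000)
    {W₁ : Submodule FunField V₁} {W₂ : Submodule FunField V₂}
    (hbot : (W₁, W₂) ≠ (⊥, ⊥)) (htop : (W₁, W₂) ≠ (⊤, ⊤))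
    (hφ : ∀ v ∈ W₁, P.φ.toLinearMap v ∈ W₂) (hD : ∀ v ∈ W₁, P.conn.toFun v ∈ W₂) :
    6 * ((P.E₁.sub W₁).degree + (P.E₂.sub W₂).degree) +
      4 * ((Module.finrank FunField W₁ : ℤ) + Module.finrank FunField W₂) +
      3 * γ * ((Module.finrank FunField W₁ : ℤ) - Module.finrank FunField W₂) ≤ 0 := by
  have := P.E₁.finite
  have := P.E₂.finite
  have hr₁ : Module.finrank FunField V₁ = 3 := P.rank₁
  have hr₂ : Module.finrank FunField V₂ = 3 := P.rank₂
  have h := hP W₁ W₂ hbot htop hφ hD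
  have hw₁ := Submodule.finrank_le W₁
  have hw₂ := Submodule.finrank_le W₂
  have hpos : 0 < Module.finrank FunField W₁ + Module.finrank FunField W₂ := by
    by_contra h0
    have h1 : Module.finrank FunField W₁ = 0 := by omega
    have h2 : Module.finrank FunField W₂ = 0 := by omega
    rw [Submodule.finrank_eq_zero] at h1 h2
    exact hbot (by rw [h1, h2])
  unfold ParabolicPhiConnection.slope VectorBundle.rank at h
  rw [VectorBundle.degree_sub_top, VectorBundle.degree_sub_top, P.degree₁, P.degree₂,
    finrank_top, finrank_top, hr₁, hr₂] at h
  have a1 := sum_weight_jump_le hr₁ P.l₁ ⊤ hα hα'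
  have a2 := sum_weight_jump_le hr₂ P.l₂ ⊤ hα hα'
  have b1 := sum_weight_jump_nonneg P.l₁ W₁ hα
  have b2 := sum_weight_jump_nonneg P.l₂ W₂ hα
  generalize ∑ i, ∑ j, α i j * (P.l₁ i).jump ⊤ j = A₁ at *
  generalize ∑ i, ∑ j, α i j * (P.l₂ i).jump ⊤ j = A₂ at *
  generalize ∑ i, ∑ j, α i j * (P.l₁ i).jump W₁ j = B₁ at *
  generalize ∑ i, ∑ j, α i j * (P.l₂ i).jump W₂ j = B₂ at *
  generalize (P.E₁.sub W₁).degree = d₁ at *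
  generalize (P.E₂.sub W₂).degree = d₂ at *
  generalize Module.finrank FunField W₁ = r₁ at *
  generalize Module.finrank FunField W₂ = r₂ at *
  have hq : (0 : ℚ) < (r₁ : ℚ) + r₂ := by exact_mod_cast hpos
  have hq' : (r₁ : ℚ) + r₂ ≤ 6 := by
    have : r₁ + r₂ ≤ 6 := by omega
    exact_mod_cast this
  rw [div_lt_div_iff₀ hq (by norm_num)] at h
  push_cast at h
  -- The sums for the full bundles are at most `27 / 1000` each and the total rank is at most 6. The
  -- product stays below 1, and the sums `B₁`, `B₂` only help.
  have hA : (A₁ + A₂) * ((r₁ : ℚ) + r₂) ≤ 54 / 1000 * 6 := by nlinarith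
  have key : (6 * ((d₁ : ℚ) + d₂) + 4 * ((r₁ : ℚ) + r₂) + 3 * γ * ((r₁ : ℚ) - r₂)) < 1 := by
    nlinarith
  have : 6 * (d₁ + d₂) + 4 * ((r₁ : ℤ) + r₂) + 3 * γ * ((r₁ : ℤ) - r₂) < 1 := by
    exact_mod_cast key
  omega

end Stability

/-! ### Degree inequalities for stable `φ`-connections -/

/-- The rank of the subbundle with a given generic fibre. -/
abbrev rk {V : Type*} [AddCommGroup V] [Module FunField V] (W : Submodule FunField V) : ℕ :=
  Module.finrank FunField W

section Numerics

variable {V₁ V₂ : Type*} [AddCommGroup V₁] [Module FunField V₁] [AddCommGroup V₂]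
  [Module FunField V₂]

/-- `N` and `M` are the kernel of the map `W → V₂ / U` induced by `f` and the preimage in `V₂`
of its image. -/
structure IsKerImage (f : V₁ → V₂) (W : Submodule FunField V₁) (U : Submodule FunField V₂)
    (N : Submodule FunField V₁) (M : Submodule FunField V₂) : Prop where
  le : N ≤ W
  ge : U ≤ M
  mem_iff : ∀ v ∈ W, v ∈ N ↔ f v ∈ U
  map_mem : ∀ v ∈ W, f v ∈ M
  min : ∀ X, U ≤ X → (∀ v ∈ W, f v ∈ X) → M ≤ X
  rank : rk W + rk U = rk M + rk N

theorem IsKerImage.map_ker {f : V₁ → V₂} {W N : Submodule FunField V₁}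
    {U M : Submodule FunField V₂} (h : IsKerImage f W U N M) : ∀ v ∈ N, f v ∈ U :=
  fun v hv => (h.mem_iff v (h.le hv)).1 hv

/-- The properties of the degrees of subbundles of `E₁` and `E₂`, for a stable `φ`-connection of
rank `3` and degree `-2` on `ℙ¹` with three poles. -/
structure StableDegrees (φ : V₁ →ₗ[FunField] V₂) (D : V₁ → V₂) (d₁ : Submodule FunField V₁ → ℤ)
    (d₂ : Submodule FunField V₂ → ℤ) (γ : ℕ) : Prop where
  gamma : 10 ≤ γ
  rank₁ : Module.finrank FunField V₁ = 3
  rank₂ : Module.finrank FunField V₂ = 3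
  bot₁ : d₁ ⊥ = 0
  bot₂ : d₂ ⊥ = 0
  top₁ : d₁ ⊤ = -2
  top₂ : d₂ ⊤ = -2
  phi : ∀ W U, ∃ N M, IsKerImage φ W U N M ∧ d₁ W - d₁ N ≤ d₂ M - d₂ U
  conn : ∀ W U, (∀ v ∈ W, φ v ∈ U) →
    ∃ N M, IsKerImage D W U N M ∧ d₁ W - d₁ N ≤ d₂ M - d₂ U + ((rk W : ℤ) - rk N)
  stable : ∀ W₁ W₂, (W₁, W₂) ≠ (⊥, ⊥) → (W₁, W₂) ≠ (⊤, ⊤) → (∀ v ∈ W₁, φ v ∈ W₂) →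
    (∀ v ∈ W₁, D v ∈ W₂) →
    6 * (d₁ W₁ + d₂ W₂) + 4 * ((rk W₁ : ℤ) + rk W₂) + 3 * γ * ((rk W₁ : ℤ) - rk W₂) ≤ 0
  line₁ : ∀ W ≠ ⊥, ∃ L ≤ W, rk L = 1 ∧ d₁ W ≤ rk W * d₁ L
  sup₂ : ∀ W U, d₂ W + d₂ U ≤ d₂ (W ⊓ U) + d₂ (W ⊔ U)

variable [Module.Finite FunField V₁] [Module.Finite FunField V₂]

theorem eq_bot_of_rk {W : Submodule FunField V₁} (h : rk W = 0) : W = ⊥ :=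
  Submodule.finrank_eq_zero.1 h

omit [Module.Finite FunField V₁] in
theorem rk_bot : rk (⊥ : Submodule FunField V₁) = 0 := finrank_bot _ _

theorem rk_mono {W W' : Submodule FunField V₁} (h : W ≤ W') : rk W ≤ rk W' :=
  Submodule.finrank_mono h

theorem eq_of_le_of_rk {W W' : Submodule FunField V₁} (h : W ≤ W') (hr : rk W = rk W') : W = W' :=
  Submodule.eq_of_le_of_finrank_eq h hr

theorem rk_sup_add_rk_inf (W W' : Submodule FunField V₁) :
    rk (W ⊔ W') + rk (W ⊓ W') = rk W + rk W' :=
  Submodule.finrank_sup_add_finrank_inf_eq W W'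

/-- `d` is at most `0` on lines and at most `-1` on planes. -/
def LinePlaneBound (d : Submodule FunField V₁ → ℤ) : Prop :=
  (∀ W, rk W = 1 → d W ≤ 0) ∧ ∀ W, rk W = 2 → d W ≤ -1

namespace StableDegrees

variable {φ : V₁ →ₗ[FunField] V₂} {D : V₁ → V₂} {d₁ : Submodule FunField V₁ → ℤ}
    {d₂ : Submodule FunField V₂ → ℤ} {γ : ℕ} (h : StableDegrees φ D d₁ d₂ γ)
include h

omit [Module.Finite FunField V₁] [Module.Finite FunField V₂] in
theorem rk_top₁ : rk (⊤ : Submodule FunField V₁) = 3 :=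
  (finrank_top FunField V₁).trans h.rank₁

omit [Module.Finite FunField V₁] [Module.Finite FunField V₂] in
theorem rk_top₂ : rk (⊤ : Submodule FunField V₂) = 3 :=
  (finrank_top FunField V₂).trans h.rank₂

omit [Module.Finite FunField V₂] in
theorem eq_top₁ {W : Submodule FunField V₁} (hW : rk W = 3) : W = ⊤ :=
  eq_of_le_of_rk le_top (hW.trans h.rk_top₁.symm)

omit [Module.Finite FunField V₁] in
theorem eq_top₂ {W : Submodule FunField V₂} (hW : rk W = 3) : W = ⊤ :=
  eq_of_le_of_rk le_top (hW.trans h.rk_top₂.symm)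

omit [Module.Finite FunField V₁] [Module.Finite FunField V₂] in
/-- The stability inequality in terms of the ranks. -/
theorem stable_of_rk {W₁ : Submodule FunField V₁} {W₂ : Submodule FunField V₂} {r₁ r₂ : ℕ}
    (hr₁ : rk W₁ = r₁) (hr₂ : rk W₂ = r₂) (hφ : ∀ v ∈ W₁, φ v ∈ W₂) (hD : ∀ v ∈ W₁, D v ∈ W₂)
    -- The ranks are numerals at each use, so `decide` rules out the zero pair and the full pair.
    (h0 : r₁ + r₂ ≠ 0 := by decide) (h6 : r₁ + r₂ ≠ 6 := by decide) :
    6 * (d₁ W₁ + d₂ W₂) + 4 * ((r₁ : ℤ) + r₂) + 3 * γ * ((r₁ : ℤ) - r₂) ≤ 0 := by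
  subst hr₁ hr₂
  refine h.stable W₁ W₂ ?_ ?_ hφ hD
  · intro heq
    obtain ⟨rfl, rfl⟩ := Prod.mk.inj heq
    simp only [rk_bot] at h0
    exact h0 rfl
  · intro heq
    obtain ⟨rfl, rfl⟩ := Prod.mk.inj heq
    rw [h.rk_top₁, h.rk_top₂] at h6
    exact h6 rfl

omit [Module.Finite FunField V₂] in
/-- A line in the kernel of `φ` has negative degree. -/
theorem line_ker {L : Submodule FunField V₁} (hL : rk L = 1) (hφ : ∀ v ∈ L, φ v = 0) :
    d₁ L ≤ -1 := by
  obtain ⟨N, M, k, hd⟩ := h.conn L ⊥ (by simpa using hφ)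
  have hr := k.rank
  have hb := h.bot₂
  rw [rk_bot] at hr
  have hφ' : ∀ X : Submodule FunField V₂, ∀ v ∈ L, φ v ∈ X := fun X v hv => by
    rw [hφ v hv]; exact X.zero_mem
  -- If `D` kills `L`, then `(L, 0)` is invariant and the `γ` term makes `d₁ L` very negative.
  -- Otherwise `(L, M)` has ranks `(1, 1)`, so `d₁ L + d₂ M ≤ -2`, while `d₁ L ≤ d₂ M + 1`.
  by_cases hN : rk N = 1
  · obtain rfl := eq_of_le_of_rk k.le (hN.trans hL.symm)
    have := h.stable_of_rk hL (rk_bot (V₁ := V₂)) (hφ' _) k.map_ker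
    omega
  · have hN0 : rk N = 0 := by omega
    obtain rfl := eq_bot_of_rk hN0
    have := h.stable_of_rk hL (show rk M = 1 by omega) (hφ' _) k.map_mem
    have := h.bot₁
    omega

/-! ### Degree bounds according to the generic rank of `φ`. -/

section Image

variable {K : Submodule FunField V₁} {I : Submodule FunField V₂}
  (k : IsKerImage φ ⊤ ⊥ K I)
include k

omit h [Module.Finite FunField V₁] [Module.Finite FunField V₂] in
theorem phi_mem_image (v : V₁) : φ v ∈ I := k.map_mem v trivial

omit h [Module.Finite FunField V₁] [Module.Finite FunField V₂] in
theorem mem_ker_iff {v : V₁} : v ∈ K ↔ φ v = 0 := by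
  rw [k.mem_iff v trivial, Submodule.mem_bot]

omit h [Module.Finite FunField V₁] [Module.Finite FunField V₂] in
theorem ker_le {W N : Submodule FunField V₁} {M : Submodule FunField V₂}
    (k' : IsKerImage φ W ⊥ N M) : N ≤ K := fun v hv =>
  (mem_ker_iff k).2 ((Submodule.mem_bot _).1 (k'.map_ker v hv))

omit h [Module.Finite FunField V₁] [Module.Finite FunField V₂] in
theorem image_le {W N : Submodule FunField V₁} {M : Submodule FunField V₂}
    (k' : IsKerImage φ W ⊥ N M) : M ≤ I :=
  k'.min I bot_le fun v _ => phi_mem_image k v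

omit h [Module.Finite FunField V₁] [Module.Finite FunField V₂] in
theorem image_eq {L M : Submodule FunField V₂} {N : Submodule FunField V₁} (hL : L ≤ I)
    (k' : IsKerImage φ ⊤ L N M) : M = I :=
  le_antisymm (k'.min I hL fun v _ => phi_mem_image k v) (k.min M bot_le k'.map_mem)

omit [Module.Finite FunField V₂] in
-- If `φ = 0`, every line lies in its kernel and has degree at most -1, but some line has degree at
-- least the slope `-2/3` of `E₁`.
theorem not_rank_zero (hI : rk I = 0) : False := by
  have hr := k.rank
  rw [rk_bot, h.rk_top₁] at hr
  obtain rfl := h.eq_top₁ (show rk K = 3 by omega)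
  obtain ⟨L, -, hL, hd⟩ := h.line₁ ⊤ (by
    rintro h0
    have := h.rk_top₁
    rw [h0, rk_bot] at this
    omega)
  have := h.line_ker hL fun v _ => (mem_ker_iff k).1 trivial
  rw [h.rk_top₁, h.top₁] at hd
  omega

/-- The kernel `K` has degree at most -2, and stability pins the image line `I` at degree 0.
Subbundles of `E₁` are cut by `K` and mapped to `I`; those of `E₂` are compared with `I` by
supermodularity. -/
theorem bound_of_rank_one (hd : d₁ ⊤ - d₁ K ≤ d₂ I - d₂ ⊥) (hI : rk I = 1) :
    LinePlaneBound d₁ ∧ LinePlaneBound d₂ := by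
  have hγ := h.gamma
  have hr := k.rank
  rw [rk_bot, h.rk_top₁] at hr
  rw [h.top₁, h.bot₂] at hd
  have hK : rk K = 2 := by omega
  have hlineK : ∀ L ≤ K, rk L = 1 → d₁ L ≤ -1 := fun L hLK hL =>
    h.line_ker hL fun v hv => (mem_ker_iff k).1 (hLK hv)
  have hK2 : d₁ K ≤ -2 := by
    obtain ⟨L, hLK, hL, hd⟩ := h.line₁ K (by rintro rfl; rw [rk_bot] at hK; omega)
    have := hlineK L hLK hL
    rw [hK] at hd
    omega
  obtain ⟨N, M, k₁, hd₁⟩ := h.conn ⊤ I fun v _ => phi_mem_image k v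
  have hr₁ := k₁.rank
  rw [h.rk_top₁, hI] at hr₁
  rw [h.top₁, h.rk_top₁] at hd₁
  have hIM := rk_mono k₁.ge
  have hM3 := rk_mono (le_top : M ≤ ⊤)
  rw [h.rk_top₂] at hM3
  have hφ : ∀ (W : Submodule FunField V₁) (X : Submodule FunField V₂), I ≤ X →
      ∀ v ∈ W, φ v ∈ X := fun W X hX v _ => hX (phi_mem_image k v)
  -- Here `d₂ I ≥ 0` follows from `hd` and `hK2`. If `M` has rank 1 or 2, the `γ` term gives a
  -- contradiction; if `M` is everything, `(N, I)` has ranks `(1, 1)` and `2 d₂ I ≤ 0` follows.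
  have hI0 : d₂ I = 0 := by
    by_cases hM1 : rk M = 1
    · have hN := h.eq_top₁ (show rk N = 3 by omega)
      subst hN
      have := h.stable_of_rk h.rk_top₁ hI (hφ _ _ le_rfl) k₁.map_ker
      have := h.top₁
      omega
    by_cases hM2 : rk M = 2
    · have s1 := h.stable_of_rk (show rk N = 2 by omega) hI (hφ _ _ le_rfl) k₁.map_ker
      have s2 := h.stable_of_rk h.rk_top₁ hM2 (hφ _ _ k₁.ge) k₁.map_mem
      have := h.top₁
      have : rk N = 2 := by omega
      omega
    · obtain rfl := h.eq_top₂ (show rk M = 3 by omega)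
      have hN1 : rk N = 1 := by omega
      have s1 := h.stable_of_rk hN1 hI (hφ _ _ le_rfl) k₁.map_ker
      have := h.top₂
      omega
  -- A plane containing `I` contains the image of `φ`, so `D` is linear modulo it. The kernel of the
  -- induced map then forms an invariant pair with the plane.
  have hplane : ∀ P, I ≤ P → rk P = 2 → d₂ P ≤ -1 := by
    intro P hP hP2
    obtain ⟨N, M, k₂, hd₂⟩ := h.conn ⊤ P (hφ _ _ hP)
    have hr₂ := k₂.rank
    rw [h.rk_top₁, hP2] at hr₂
    rw [h.top₁, h.rk_top₁] at hd₂
    have hPM := rk_mono k₂.ge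
    have hM3 := rk_mono (le_top : M ≤ ⊤)
    rw [h.rk_top₂] at hM3
    by_cases hM2 : rk M = 2
    · have hN := h.eq_top₁ (show rk N = 3 by omega)
      subst hN
      have := h.stable_of_rk h.rk_top₁ hP2 (hφ _ _ hP) k₂.map_ker
      have := h.top₁
      omega
    · obtain rfl := h.eq_top₂ (show rk M = 3 by omega)
      have hN2 : rk N = 2 := by omega
      have := h.stable_of_rk hN2 hP2 (hφ _ _ hP) k₂.map_ker
      have := h.top₂
      omega
  refine ⟨⟨fun L hL => ?_, fun G hG => ?_⟩, ⟨fun L hL => ?_, fun G hG => ?_⟩⟩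
  · obtain ⟨N', M', k', hd'⟩ := h.phi L ⊥
    have hr' := k'.rank
    rw [rk_bot] at hr'
    have hMI := rk_mono (image_le k k')
    have := h.bot₂
    by_cases hN : rk N' = 1
    · obtain rfl := eq_of_le_of_rk k'.le (hN.trans hL.symm)
      have := hlineK N' (ker_le k k') hL
      omega
    · obtain rfl := eq_bot_of_rk (show rk N' = 0 by omega)
      obtain rfl := eq_of_le_of_rk (image_le k k') (show rk M' = rk I by omega)
      have := h.bot₁
      omega
  · obtain ⟨N', M', k', hd'⟩ := h.phi G ⊥
    have hr' := k'.rank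
    rw [rk_bot] at hr'
    have hMI := rk_mono (image_le k k')
    have := h.bot₂
    by_cases hN : rk N' = 2
    · obtain rfl := eq_of_le_of_rk k'.le (hN.trans hG.symm)
      obtain rfl := eq_of_le_of_rk (ker_le k k') (hG.trans hK.symm)
      omega
    · have := hlineK N' (ker_le k k') (by omega)
      obtain rfl := eq_of_le_of_rk (image_le k k') (show rk M' = rk I by omega)
      omega
  · have hs := rk_sup_add_rk_inf L I
    have hd' := h.sup₂ L I
    have hinf := rk_mono (inf_le_left : L ⊓ I ≤ L)
    have := h.bot₂
    by_cases h1 : rk (L ⊓ I) = 1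
    · have e1 := eq_of_le_of_rk (inf_le_left : L ⊓ I ≤ L) (h1.trans hL.symm)
      have e2 := eq_of_le_of_rk (inf_le_right : L ⊓ I ≤ I) (h1.trans hI.symm)
      rw [← e1, e2, hI0]
    · have h0 := eq_bot_of_rk (show rk (L ⊓ I) = 0 by omega)
      have := hplane (L ⊔ I) le_sup_right (by omega)
      rw [h0] at hd'
      omega
  · have hs := rk_sup_add_rk_inf G I
    have hd' := h.sup₂ G I
    have hinf := rk_mono (inf_le_right : G ⊓ I ≤ I)
    have := h.bot₂
    by_cases h1 : rk (G ⊓ I) = 1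
    · have e2 := eq_of_le_of_rk (inf_le_right : G ⊓ I ≤ I) (h1.trans hI.symm)
      exact hplane G (e2 ▸ inf_le_left) hG
    · have h0 := eq_bot_of_rk (show rk (G ⊓ I) = 0 by omega)
      rw [h0, h.eq_top₂ (show rk (G ⊔ I) = 3 by omega), h.top₂] at hd'
      omega

/-- A line of positive degree in the image would have a preimage plane `N` with `d₁ N ≥ d₂ L - 1`.
Applying `D` to `N` modulo `L` then contradicts stability, or the degree of `E₂`, for every possible
rank of the kernel. -/
theorem line_le_image (hI : rk I = 2) (hdI : d₂ I = -1)
    {L : Submodule FunField V₂} (hLI : L ≤ I) (hL : rk L = 1) : d₂ L ≤ 0 := by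
  have hγ := h.gamma
  by_contra hx
  obtain ⟨N, M, k₁, hd₁⟩ := h.phi ⊤ L
  obtain rfl := image_eq k hLI k₁
  have hr₁ := k₁.rank
  rw [h.rk_top₁] at hr₁
  have hN : rk N = 2 := by omega
  rw [h.top₁] at hd₁
  obtain ⟨N₂, M₂, k₂, hd₂⟩ := h.conn N L k₁.map_ker
  have hr₂ := k₂.rank
  have hN₂ := rk_mono k₂.le
  by_cases h2 : rk N₂ = 2
  · obtain rfl := eq_of_le_of_rk k₂.le (h2.trans hN.symm)
    have := h.stable_of_rk hN hL k₁.map_ker k₂.map_ker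
    omega
  by_cases h1 : rk N₂ = 1
  · have s1 := h.stable_of_rk h1 hL (fun v hv => k₁.map_ker v (k₂.le hv)) k₂.map_ker
    have s2 := h.stable_of_rk hN (show rk M₂ = 2 by omega)
      (fun v hv => k₂.ge (k₁.map_ker v hv)) k₂.map_mem
    omega
  · obtain rfl := h.eq_top₂ (show rk M₂ = 3 by omega)
    obtain rfl := eq_bot_of_rk (show rk N₂ = 0 by omega)
    have := h.top₂
    have := h.bot₁
    omega

/-- Stability pins the image plane `I` at degree -1, and `line_le_image` bounds its lines. The
kernel line has degree at most -1, so `φ` carries these bounds to `E₁`; supermodularity with `I`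
carries them to `E₂`. -/
theorem bound_of_rank_two (hd : d₁ ⊤ - d₁ K ≤ d₂ I - d₂ ⊥) (hI : rk I = 2) :
    LinePlaneBound d₁ ∧ LinePlaneBound d₂ := by
  have hγ := h.gamma
  have hr := k.rank
  rw [rk_bot, h.rk_top₁] at hr
  rw [h.top₁, h.bot₂] at hd
  have hK : rk K = 1 := by omega
  have hdK : d₁ K ≤ -1 := h.line_ker hK fun v hv => (mem_ker_iff k).1 hv
  obtain ⟨N, M, k₁, hd₁⟩ := h.conn ⊤ I fun v _ => phi_mem_image k v
  have hr₁ := k₁.rank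
  rw [h.rk_top₁, hI] at hr₁
  rw [h.top₁, h.rk_top₁] at hd₁
  have hIM := rk_mono k₁.ge
  have hM3 := rk_mono (le_top : M ≤ ⊤)
  rw [h.rk_top₂] at hM3
  have hφ : ∀ W : Submodule FunField V₁, ∀ v ∈ W, φ v ∈ I := fun W v _ => phi_mem_image k v
  have hI1 : d₂ I = -1 := by
    by_cases hM2 : rk M = 2
    · have hN := h.eq_top₁ (show rk N = 3 by omega)
      subst hN
      have := h.stable_of_rk h.rk_top₁ hI (hφ _) k₁.map_ker
      have := h.top₁
      omega
    · obtain rfl := h.eq_top₂ (show rk M = 3 by omega)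
      have hN2 : rk N = 2 := by omega
      have := h.stable_of_rk hN2 hI (hφ _) k₁.map_ker
      have := h.top₂
      omega
  have hline : ∀ L ≤ I, rk L = 1 → d₂ L ≤ 0 := fun L hLI hL =>
    h.line_le_image k hI hI1 hLI hL
  refine ⟨⟨fun L hL => ?_, fun G hG => ?_⟩, ⟨fun L hL => ?_, fun G hG => ?_⟩⟩
  · obtain ⟨N', M', k', hd'⟩ := h.phi L ⊥
    have hr' := k'.rank
    rw [rk_bot] at hr'
    have := h.bot₂
    by_cases hN : rk N' = 1
    · obtain rfl := eq_of_le_of_rk k'.le (hN.trans hL.symm)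
      obtain rfl := eq_of_le_of_rk (ker_le k k') (hL.trans hK.symm)
      omega
    · obtain rfl := eq_bot_of_rk (show rk N' = 0 by omega)
      have := hline M' (image_le k k') (by omega)
      have := h.bot₁
      omega
  · obtain ⟨N', M', k', hd'⟩ := h.phi G ⊥
    have hr' := k'.rank
    rw [rk_bot] at hr'
    have hNK := rk_mono (ker_le k k')
    have := h.bot₂
    by_cases hN : rk N' = 1
    · obtain rfl := eq_of_le_of_rk (ker_le k k') (hN.trans hK.symm)
      have := hline M' (image_le k k') (by omega)
      omega
    · obtain rfl := eq_bot_of_rk (show rk N' = 0 by omega)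
      obtain rfl := eq_of_le_of_rk (image_le k k') (show rk M' = rk I by omega)
      have := h.bot₁
      omega
  · have hs := rk_sup_add_rk_inf L I
    have hd' := h.sup₂ L I
    have hinf := rk_mono (inf_le_left : L ⊓ I ≤ L)
    have := h.bot₂
    by_cases h1 : rk (L ⊓ I) = 1
    · have e1 := eq_of_le_of_rk (inf_le_left : L ⊓ I ≤ L) (h1.trans hL.symm)
      exact hline L (e1 ▸ inf_le_right) hL
    · have h0 := eq_bot_of_rk (show rk (L ⊓ I) = 0 by omega)
      rw [h0, h.eq_top₂ (show rk (L ⊔ I) = 3 by omega), h.top₂] at hd'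
      omega
  · have hs := rk_sup_add_rk_inf G I
    have hd' := h.sup₂ G I
    have hinf := rk_mono (inf_le_left : G ⊓ I ≤ G)
    have hsup := rk_mono (le_top : G ⊔ I ≤ ⊤)
    rw [h.rk_top₂] at hsup
    by_cases h1 : rk (G ⊓ I) = 2
    · have e1 := eq_of_le_of_rk (inf_le_left : G ⊓ I ≤ G) (h1.trans hG.symm)
      have e2 := eq_of_le_of_rk (inf_le_right : G ⊓ I ≤ I) (h1.trans hI.symm)
      rw [← e1, e2, hI1]
    · have := hline (G ⊓ I) inf_le_right (by omega)
      rw [h.eq_top₂ (show rk (G ⊔ I) = 3 by omega), h.top₂] at hd'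
      omega

omit [Module.Finite FunField V₂] in
theorem exists_image_of_rank_three (hI : rk I = 3) (W : Submodule FunField V₁) :
    ∃ M, IsKerImage φ W ⊥ ⊥ M ∧ rk M = rk W ∧ d₁ W ≤ d₂ M := by
  have hr := k.rank
  rw [rk_bot, h.rk_top₁] at hr
  obtain ⟨N, M, k', hd⟩ := h.phi W ⊥
  have hNK := rk_mono (ker_le k k')
  obtain rfl := eq_bot_of_rk (show rk N = 0 by omega)
  have hr' := k'.rank
  rw [rk_bot, rk_bot] at hr'
  have := h.bot₁
  have := h.bot₂
  exact ⟨M, k', by omega, by omega⟩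

omit [Module.Finite FunField V₁] in
-- The reverse comparison holds because `E₁` and `E₂` have the same degree: a generically bijective
-- `φ` loses none.
theorem exists_preimage_of_rank_three (hI : rk I = 3) (W : Submodule FunField V₂) :
    ∃ N, rk N = rk W ∧ d₂ W ≤ d₁ N := by
  obtain rfl := h.eq_top₂ hI
  obtain ⟨N, M, k', hd⟩ := h.phi ⊤ W
  obtain rfl := image_eq k le_top k'
  have hr' := k'.rank
  rw [h.rk_top₁, h.rk_top₂] at hr'
  rw [h.top₁, h.top₂] at hd
  exact ⟨N, by omega, by omega⟩

/-- Degrees can be compared in both directions through `φ`, so it suffices to treat `E₁`. Lines or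
planes of too large degree are moved by `D`, and the images are again too large. -/
theorem bound_of_rank_three (hI : rk I = 3) : LinePlaneBound d₁ ∧ LinePlaneBound d₂ := by
  -- A line with `d₁ L ≥ 0` cannot satisfy `D(L) ⊆ φ(L)`, as the pair would have total degree at
  -- least 0. Hence `Y = φ(L)` and `D(L)` span a plane `Y'`.
  have step : ∀ L, rk L = 1 → 0 ≤ d₁ L → ∃ Y, IsKerImage φ L ⊥ ⊥ Y ∧ rk Y = 1 ∧ d₁ L ≤ d₂ Y ∧
      ∃ Y', IsKerImage D L Y ⊥ Y' ∧ rk Y' = 2 ∧ d₁ L + d₂ Y ≤ d₂ Y' + 1 := by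
    intro L hL h0
    obtain ⟨Y, kY, hY, hdY⟩ := h.exists_image_of_rank_three k hI L
    obtain ⟨N, Y', k', hd'⟩ := h.conn L Y kY.map_mem
    have hr' := k'.rank
    have hN := rk_mono k'.le
    by_cases hN1 : rk N = 1
    · obtain rfl := eq_of_le_of_rk k'.le (hN1.trans hL.symm)
      have := h.stable_of_rk hL (hY.trans hL) kY.map_mem k'.map_ker
      omega
    · obtain rfl := eq_bot_of_rk (show rk N = 0 by omega)
      have := h.bot₁
      rw [hL, rk_bot] at hd'
      exact ⟨Y, kY, by omega, hdY, Y', k', by omega, by omega⟩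
  have plane : ∀ G, rk G = 2 → d₁ G ≤ -1 := by
    intro G hG
    by_contra hs
    obtain ⟨M, kM, hM, hdM⟩ := h.exists_image_of_rank_three k hI G
    obtain ⟨N, M', k', hd'⟩ := h.conn G M kM.map_mem
    have hr' := k'.rank
    have hN := rk_mono k'.le
    have hM3 := rk_mono (le_top : M' ≤ ⊤)
    rw [h.rk_top₂] at hM3
    by_cases hN2 : rk N = 2
    · obtain rfl := eq_of_le_of_rk k'.le (hN2.trans hG.symm)
      have := h.stable_of_rk hG (hM.trans hG) kM.map_mem k'.map_ker
      omega
    · obtain rfl := h.eq_top₂ (show rk M' = 3 by omega)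
      have htop := h.top₂
      -- Here `d₁ N ≥ d₁ G + d₂ M + 1`. The plane produced from `N` lies in `M`, hence equals it,
      -- and `2 d₁ N ≤ d₂ M + 1` contradicts `d₂ M ≥ 0`.
      obtain ⟨Y, kY, hY, hdY, Y', kY', hY', hdY'⟩ := step N (by omega) (by omega)
      have hYM : Y ≤ M := kY.min M bot_le fun v hv => kM.map_mem v (k'.le hv)
      have hYM' : Y' ≤ M := kY'.min M hYM k'.map_ker
      obtain rfl := eq_of_le_of_rk hYM' (by omega)
      omega
  have plane₂ : ∀ G, rk G = 2 → d₂ G ≤ -1 := fun G hG => by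
    obtain ⟨N, hN, hd⟩ := h.exists_preimage_of_rank_three k hI G
    exact hd.trans (plane N (hN.trans hG))
  have line : ∀ L, rk L = 1 → d₁ L ≤ 0 := by
    intro L hL
    by_contra hs
    obtain ⟨Y, kY, hY, hdY, Y', kY', hY', hdY'⟩ := step L hL (by omega)
    have := plane₂ Y' hY'
    omega
  refine ⟨⟨line, plane⟩, ⟨fun L hL => ?_, plane₂⟩⟩
  obtain ⟨N, hN, hd⟩ := h.exists_preimage_of_rank_three k hI L
  exact hd.trans (line N (hN.trans hL))

end Image

theorem linePlaneBound : LinePlaneBound d₁ ∧ LinePlaneBound d₂ := by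
  obtain ⟨K, I, k, hd⟩ := h.phi ⊤ ⊥
  have hI := rk_mono (le_top : I ≤ ⊤)
  rw [h.rk_top₂] at hI
  rcases (show rk I = 0 ∨ rk I = 1 ∨ rk I = 2 ∨ rk I = 3 by omega) with h0 | h1 | h2 | h3
  · exact (h.not_rank_zero k h0).elim
  · exact h.bound_of_rank_one k hd h1
  · exact h.bound_of_rank_two k hd h2
  · exact h.bound_of_rank_three k h3

end StableDegrees

end Numerics

/-! ### From stability to the splitting type. -/

section Main

variable {V₁ V₂ : Type*} [AddCommGroup V₁] [Module FunField V₁] [AddCommGroup V₂]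
  [Module FunField V₂]

theorem ParabolicPhiConnection.IsStable.stableDegrees {t : Fin 3 → P1}
    (ht : Function.Injective t) {ν : Fin 3 → Fin 3 → ℂ}
    {P : ParabolicPhiConnection V₁ V₂ (-2) t ν} {α : Fin 3 → Fin 3 → ℚ} {γ : ℕ}
    (hγ : 10 ≤ γ) (hP : P.IsStable α γ) (hα : IsParabolicWeight α)
    (hα' : ∀ i j, α i j < 1 / 1000) :
    StableDegrees P.φ.toLinearMap P.conn.toFun (fun W => (P.E₁.sub W).degree)
      (fun W => (P.E₂.sub W).degree) γ where
  gamma := hγ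
  rank₁ := P.rank₁
  rank₂ := P.rank₂
  bot₁ := P.E₁.degree_sub_bot
  bot₂ := P.E₂.degree_sub_bot
  top₁ := P.E₁.degree_sub_top.trans P.degree₁
  top₂ := P.E₂.degree_sub_top.trans P.degree₂
  phi W U := by
    obtain ⟨N, M, h1, h2, h3, h4, h5, h6, hd⟩ := P.E₁.exists_ker_image P.E₂
      P.φ.toLinearMap.toAddMonoidHom (fun _ => 1) (fun _ => one_ne_zero) (by simp [logVal_one])
      (fun p v hv => by rw [one_smul]; exact P.φ.map_stalk p v hv) W U
      (fun a v _ => by simp)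
    simp only [logVal_one, finsum_zero, mul_zero, add_zero] at hd
    exact ⟨N, M, ⟨h1, h2, h3, h4, h5, h6⟩, hd⟩
  conn W U hφ := by
    obtain ⟨N, M, h1, h2, h3, h4, h5, h6, hd⟩ := P.E₁.exists_ker_image P.E₂
      P.conn.toFun (logTwist t) (logTwist_ne_zero t) (finite_support_logVal_logTwist t)
      P.conn.logTwist_smul_mem W U
      -- The failure of linearity is the Leibniz term `derivZ a • φ v`, which lies in `U` because
      -- `φ(W) ⊆ U`.
      (fun a v hv => by
        rw [P.conn.leibniz, add_sub_cancel_right]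
        exact U.smul_mem _ (hφ v hv))
    rw [finsum_logVal_logTwist t ht] at hd
    refine ⟨N, M, ⟨h1, h2, h3, h4, h5, h6⟩, ?_⟩
    push_cast at hd
    linarith
  stable _ _ h0 h1 hφ hD := hP.degree_bound hα hα' h0 h1 hφ hD
  line₁ W hW := P.E₁.exists_line hW
  sup₂ W U := P.E₂.degree_add_degree_le W U

theorem ParabolicPhiConnection.IsStable.subDegreeBounds {t : Fin 3 → P1}
    (ht : Function.Injective t) {ν : Fin 3 → Fin 3 → ℂ}
    {P : ParabolicPhiConnection V₁ V₂ (-2) t ν} {α : Fin 3 → Fin 3 → ℚ} {γ : ℕ}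
    (hγ : 10 ≤ γ) (hP : P.IsStable α γ) (hα : IsParabolicWeight α)
    (hα' : ∀ i j, α i j < 1 / 1000) : P.E₁.SubDegreeBounds ∧ P.E₂.SubDegreeBounds := by
  have := P.E₁.finite
  have := P.E₂.finite
  obtain ⟨⟨h1, h2⟩, h3, h4⟩ := (hP.stableDegrees ht hγ hα hα').linePlaneBound
  exact ⟨⟨h1, h2⟩, ⟨h3, h4⟩⟩

end Main

end PhiConn

end

theorem mainTheorem6 :
    ∃ ε : ℚ, 0 < ε ∧ ∃ γ₀ : ℕ,
      ∀ (α : Fin 3 → Fin 3 → ℚ), PhiConn.IsParabolicWeight α → (∀ i j, α i j < ε) →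
      ∀ γ : ℕ, γ₀ ≤ γ →
      ∀ (t : Fin 3 → PhiConn.P1), Function.Injective t →
      ∀ ν ∈ PhiConn.localExponents 3 3 (-2),
      ∀ (V₁ V₂ : Type*) [AddCommGroup V₁] [Module PhiConn.FunField V₁]
        [AddCommGroup V₂] [Module PhiConn.FunField V₂]
        (P : PhiConn.ParabolicPhiConnection V₁ V₂ (-2) t ν),
        P.IsStable α γ →
        (Nonempty (P.E₁.Iso ((PhiConn.lineBundle 0).prod
            ((PhiConn.lineBundle (-1)).prod (PhiConn.lineBundle (-1))))) ∧
          Nonempty (P.E₂.Iso ((PhiConn.lineBundle 0).prod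
            ((PhiConn.lineBundle (-1)).prod (PhiConn.lineBundle (-1)))))) ∧
        (∃! W : Submodule PhiConn.FunField V₁,
          Nonempty ((P.E₁.sub W).Iso (PhiConn.lineBundle 0))) ∧
        (∃! W : Submodule PhiConn.FunField V₂,
          Nonempty ((P.E₂.sub W).Iso (PhiConn.lineBundle 0))) := by
  -- The bound on the weights keeps their contribution below 1 after clearing denominators. With `γ
  -- ≥ 10` an invariant pair of ranks `r₁ > r₂` has total degree at most -6, ample for all the case
  -- distinctions.
  refine ⟨1 / 1000, by norm_num, 10, ?_⟩
  intro α hα hα' γ hγ t ht ν _ V₁ V₂ _ _ _ _ P hP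
  obtain ⟨h₁, h₂⟩ := hP.subDegreeBounds ht hγ hα hα'
  have i₁ := P.E₁.nonempty_iso_of_bounds P.rank₁ P.degree₁ h₁
  have i₂ := P.E₂.nonempty_iso_of_bounds P.rank₂ P.degree₂ h₂
  exact ⟨⟨i₁, i₂⟩, P.E₁.existsUnique_sub_iso h₁ i₁, P.E₂.existsUnique_sub_iso h₂ i₂⟩
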